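/- **Proposition 2.1** ($L^1$-mean contraction). Let $f_i, A_{ij}, \sigma_{ik}:\mathbb R\to\mathbb R$ ($1\le i,j,k\le d$) be $C^\infty$ functions such that $A_{ij}=A_{ji}$ and $a_{ij}:=A_{ij}'=\sum_{k=1}^d\sigma_{ik}\sigma_{jk}$. Consider the Cauchy problem $$\partial_t u+\nabla\cdot \mathbf f(u)=\sum_{i,j=1}^d\partial^2_{x_ix_j}A_{ij}(u)\quad (t>0,\ x\in\mathbb R^d),\qquad u(0,x)=u_0(x),\tag{P}$$ with $u_0\in L^\infty(\mathbb R^d)$. For $R>0$ let $I_R=\{x\in\mathbb R^d: \max_i|x_i|\le R/2\}$, and for measurable $g$ let $$N_1(g)=\limsup_{R\to\infty}\frac1{R^d}\int_{I_R}|g(x)|\,dx .$$ An entropy solution of (P) is a function $u\in L^\infty((0,\infty)\times\mathbb R^d)$ such that, derivatives and inequalities being understood in the sense of distributions on $(0,\infty)\times\mathbb R^d$: 1. for each $k$, with $\beta_{ik}'=\sigma_{ik}$, the distribution $g_k:=\sum_{i}\partial_{x_i}\beta_{ik}(u)$ is a function in $L^2((0,\infty)\times I_R)$ for every $R>0$;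 2. for every $\psi\in C(\mathbb R)$ and every $k$, with $(\beta^\psi_{ik})'=\psi\,\sigma_{ik}$, one has $\sum_i\partial_{x_i}\beta^\psi_{ik}(u)=\psi(u)\,g_k\in L^2((0,\infty)\times I_R)$ for every $R>0$; 3. for every convex $\eta\in C^2(\mathbb R)$, with $q_i'=\eta' f_i'$ and $r_{ij}'=\eta' a_{ij}$, $$\partial_t\eta(u)+\nabla\cdot\mathbf q(u)-\sum_{i,j}\partial^2_{x_ix_j}r_{ij}(u)\le-\eta''(u)\sum_{k}g_k^2;$$ 4. for every $R>0$, $\int_{I_R}|u(t,x)-u_0(x)|\,dx\to0$ as $t\to0+$ (as an essential limit, that is, with $t$ outside a null set). Let $u,v$ be entropy solutions of (P) with initial functions $u_0,v_0\in L^\infty(\mathbb R^d)$ respectively. Then there is a set $F\subseteq(0,\infty)$ of full Lebesgue measure such that for all $t_0,t_1\in F$ with $t_0<t_1$ $$N_1(u(t_1,\cdot)-v(t_1,\cdot))\le N_1(u(t_0,\cdot)-v(t_0,\cdot)),$$ and moreover, for a.e. $t>0$, $$N_1(u(t,\cdot)-v(t,\cdot))\le N_1(u_0-v_0).$$ -/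

import Mathlib

open Set Filter Topology MeasureTheory
open scoped ENNReal ContDiff

noncomputable section

namespace DegenerateParabolic

/-- The closed cube `I_R = {x ∈ ℝ^d : max_i |x_i| ≤ R / 2}`. -/
def cube (d : ℕ) (R : ℝ) : Set (Fin d → ℝ) := {x | ∀ i, |x i| ≤ R / 2}

/-- The Besicovitch seminorm `N₁(g) = limsup_{R → ∞} R^{-d} ∫_{I_R} |g(x)| dx`, with values
in `[0, ∞]`. -/
def besicovitchN1 {d : ℕ} (g : (Fin d → ℝ) → ℝ) : ℝ≥0∞ :=
  limsup (fun R : ℝ => (∫⁻ x in cube d R, ‖g x‖ₑ) / ENNReal.ofReal R ^ d) atTop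

/-- The open half space `(0, ∞) × ℝ^d`. -/
def halfSpace (d : ℕ) : Set (ℝ × (Fin d → ℝ)) := Ioi 0 ×ˢ univ

/-- Test functions `φ ∈ C_c^∞((0, ∞) × ℝ^d)`. -/
structure IsTestFunction {d : ℕ} (φ : ℝ × (Fin d → ℝ) → ℝ) : Prop where
  smooth : ContDiff ℝ ∞ φ
  compact : HasCompactSupport φ
  supp : tsupport φ ⊆ halfSpace d

/-- The time derivative `∂_t φ`. -/
def dt {d : ℕ} (φ : ℝ × (Fin d → ℝ) → ℝ) (z : ℝ × (Fin d → ℝ)) : ℝ :=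
  fderiv ℝ φ z (1, 0)

/-- The space derivative `∂_{x_i} φ`. -/
def dx {d : ℕ} (i : Fin d) (φ : ℝ × (Fin d → ℝ) → ℝ) (z : ℝ × (Fin d → ℝ)) : ℝ :=
  fderiv ℝ φ z (0, Pi.single i 1)

/-- `∑_i ∂_{x_i} F_i = g` in the sense of distributions on `(0, ∞) × ℝ^d`. -/
def HasWeakDiv {d : ℕ} (F : Fin d → ℝ × (Fin d → ℝ) → ℝ) (g : ℝ × (Fin d → ℝ) → ℝ) : Prop :=
  ∀ φ : ℝ × (Fin d → ℝ) → ℝ, IsTestFunction φ →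
    ∫ z in halfSpace d, ∑ i, F i z * dx i φ z = -∫ z in halfSpace d, g z * φ z

/-- `g ∈ L²((0, ∞) × I_R)` for every `R > 0`. -/
def MemL2Cubes {d : ℕ} (g : ℝ × (Fin d → ℝ) → ℝ) : Prop :=
  ∀ R : ℝ, 0 < R → MemLp g 2 (volume.restrict (Ioi (0 : ℝ) ×ˢ cube d R))

/-- The primitive `w ↦ ∫_0^w h(s) ds`. -/
def primitive (h : ℝ → ℝ) (w : ℝ) : ℝ := ∫ s in (0 : ℝ)..w, h s

/-- Standing assumptions on the data of `∂_t u + ∇ · f(u) = ∑_{ij} ∂²_{x_i x_j} A_ij(u)`: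
`f`, `A`, `σ` are smooth, `A` is symmetric, and `A_ij' = ∑_k σ_ik σ_jk`
(so that the matrix `A'(w)` is automatically nonnegative). -/
structure IsData {d : ℕ} (f : Fin d → ℝ → ℝ) (A σ : Fin d → Fin d → ℝ → ℝ) : Prop where
  smooth_f : ∀ i, ContDiff ℝ ∞ (f i)
  smooth_A : ∀ i j, ContDiff ℝ ∞ (A i j)
  smooth_σ : ∀ i k, ContDiff ℝ ∞ (σ i k)
  symm : ∀ i j, A i j = A j i
  factor : ∀ i j w, deriv (A i j) w = ∑ k, σ i k w * σ j k w

/-- The entropy inequality for the entropy `η`, in the sense of distributions on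
`(0, ∞) × ℝ^d`:
`∂_t η(u) + ∇ · q(u) - ∑_{ij} ∂²_{x_i x_j} r_ij(u) ≤ -η''(u) ∑_k g_k²`,
where `q_i' = η' f_i'` and `r_ij' = η' A_ij'`. -/
def EntropyInequality {d : ℕ} (f : Fin d → ℝ → ℝ) (A : Fin d → Fin d → ℝ → ℝ)
    (u : ℝ × (Fin d → ℝ) → ℝ) (g : Fin d → ℝ × (Fin d → ℝ) → ℝ) (η : ℝ → ℝ) : Prop :=
  ∀ φ : ℝ × (Fin d → ℝ) → ℝ, IsTestFunction φ → (∀ z, 0 ≤ φ z) →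
    ∫ z in halfSpace d, deriv (deriv η) (u z) * (∑ k, g k z ^ 2) * φ z ≤
      ∫ z in halfSpace d,
        (η (u z) * dt φ z
          + ∑ i, primitive (fun s => deriv η s * deriv (f i) s) (u z) * dx i φ z
          + ∑ i, ∑ j, primitive (fun s => deriv η s * deriv (A i j) s) (u z)
              * dx i (dx j φ) z)

/-- `u` is an (`L^∞`) entropy solution of
`∂_t u + ∇ · f(u) = ∑_{ij} ∂²_{x_i x_j} A_ij(u)` with initial function `u₀`. -/
structure IsEntropySolution {d : ℕ} (f : Fin d → ℝ → ℝ) (A σ : Fin d → Fin d → ℝ → ℝ)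
    (u₀ : (Fin d → ℝ) → ℝ) (u : ℝ × (Fin d → ℝ) → ℝ) : Prop where
  memLp_init : MemLp u₀ ∞ volume
  memLp : MemLp u ∞ (volume.restrict (halfSpace d))
  /-- Regularity, chain rule and entropy inequality; `g k` is the function
  `∑_i ∂_{x_i} β_ik(u)` with `β_ik' = σ_ik`. -/
  interior : ∃ g : Fin d → ℝ × (Fin d → ℝ) → ℝ,
    (∀ k, MemL2Cubes (g k) ∧ HasWeakDiv (fun i z => primitive (σ i k) (u z)) (g k)) ∧
    (∀ ψ : ℝ → ℝ, Continuous ψ → ∀ k,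
      MemL2Cubes (fun z => ψ (u z) * g k z) ∧
      HasWeakDiv (fun i z => primitive (fun s => ψ s * σ i k s) (u z))
        (fun z => ψ (u z) * g k z)) ∧
    (∀ η : ℝ → ℝ, ContDiff ℝ 2 η → ConvexOn ℝ univ η → EntropyInequality f A u g η)
  /-- The initial condition. As `u` is only determined almost everywhere, the limit as
  `t → 0+` is an essential limit (`t` avoids some null set). -/
  initial : ∀ R : ℝ, 0 < R →
    Tendsto (fun t : ℝ => ∫⁻ x in cube d R, ‖u (t, x) - u₀ x‖ₑ)
      (𝓝[>] (0 : ℝ) ⊓ ae volume) (𝓝 0)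

end DegenerateParabolic

end

/-! The proof is Kruzhkov's doubling of variables, with the parabolic dissipation used to supply the
missing mixed derivatives. Take the entropy η(s) = √(s² + ε²). Test the inequality for u(z) with the
constant v(w), test the one for v(w) with the constant u(z), use the same Φ(z, w) ≥ 0 in both, and
add. Since g_k² + h_k² ≥ 2 g_k h_k, the dissipation is at least 2 ∑_k ∫∫ η''(u - v) g_k h_k Φ. The
chain rule, applied once in z and once in w, rewrites this as an integral of a kernel against
∂_{x_i}∂_{y_j}Φ (`integral_mixed`).

As ε → 0 that kernel tends to -sgn(u - v) ∫_v^u σ_ik σ_jk, and the sum over k restores a_ij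
(`tendsto_crossInt`, `doubled_kruzhkov`). These are exactly the cross terms that complete
∂_{x_i}∂_{x_j} + ∂_{y_i}∂_{y_j} to (∂_{x_i} + ∂_{y_i})(∂_{x_j} + ∂_{y_j}). Every derivative of Φ is
now along the diagonal, so for Φ = ψ(z) ρ_n(z - w) none falls on the mollifier ρ_n. Letting n → ∞
therefore needs only Lebesgue points of v, and gives Kato's inequality for |u - v| (`kruzhkov`).

Testing that inequality with θ(t)χ(x) shows that ∫ |u - v| χ dx grows in time at most at a rate
controlled by the L¹ norms of the first and second derivatives of χ, because the fluxes are bounded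
on bounded sets (`exists_localized_growth`). For χ(x/N) with N ≥ 1 this rate is O(N^(d-1)),
negligible against the volume N^d. Cutoffs squeezed between cubes whose sides have ratio 1 +
1/(m+1), with N → ∞ and then m → ∞, give the comparison of seminorms
(`besicovitchN1_le_of_cutoffNorm_le`). Only countably many cutoffs occur, so the exceptional times
form one null set. For the initial data, the limit t₀ → 0+ is taken for each fixed cutoff, before
the large-scale limit. -/

namespace DegenerateParabolic

/-! ### Smooth approximation of the absolute value -/

/-- The smooth approximation `s ↦ √(s² + ε²)` of `|s|`. -/
noncomputable def softAbs (ε s : ℝ) : ℝ := √(s ^ 2 + ε ^ 2)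

/-- The derivative of `softAbs ε`. -/
noncomputable def softSign (ε s : ℝ) : ℝ := s / √(s ^ 2 + ε ^ 2)

/-- The second derivative of `softAbs ε`. -/
noncomputable def softDelta (ε s : ℝ) : ℝ := ε ^ 2 / ((s ^ 2 + ε ^ 2) * √(s ^ 2 + ε ^ 2))

section SoftAbs

variable {ε : ℝ} (hε : 0 < ε)
include hε

theorem sq_add_sq_pos (s : ℝ) : 0 < s ^ 2 + ε ^ 2 := by positivity

theorem hasDerivAt_softAbs (s : ℝ) : HasDerivAt (softAbs ε) (softSign ε s) s := by
  have h := sq_add_sq_pos hε s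
  have h1 : HasDerivAt (fun s : ℝ => s ^ 2 + ε ^ 2) (2 * s) s := by
    simpa using (hasDerivAt_pow 2 s).add_const (ε ^ 2)
  have h2 := h1.sqrt h.ne'
  refine h2.congr_deriv ?_
  unfold softSign
  have := Real.sqrt_pos.2 h
  field_simp

theorem hasDerivAt_softSign (s : ℝ) : HasDerivAt (softSign ε) (softDelta ε s) s := by
  have h := sq_add_sq_pos hε s
  have h0 := Real.sqrt_pos.2 h
  have h2 := (hasDerivAt_id s).div (hasDerivAt_softAbs hε s) h0.ne'
  refine h2.congr_deriv ?_
  simp only [softDelta, softSign, softAbs, id]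
  have h3 := Real.sq_sqrt h.le
  field_simp
  rw [h3]; ring

theorem continuous_softAbs : Continuous (softAbs ε) :=
  continuous_iff_continuousAt.2 fun s => (hasDerivAt_softAbs hε s).continuousAt

theorem continuous_softSign : Continuous (softSign ε) :=
  continuous_iff_continuousAt.2 fun s => (hasDerivAt_softSign hε s).continuousAt

theorem continuous_softDelta : Continuous (softDelta ε) := by
  unfold softDelta
  refine Continuous.div (by fun_prop) (by fun_prop) fun s => ?_
  have h := sq_add_sq_pos hε s
  have h0 := Real.sqrt_pos.2 h
  positivity

theorem softDelta_nonneg (s : ℝ) : 0 ≤ softDelta ε s := by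
  unfold softDelta; positivity

theorem deriv_softAbs_sub (c : ℝ) :
    deriv (fun s => softAbs ε (s - c)) = fun s => softSign ε (s - c) := by
  funext s
  exact ((hasDerivAt_softAbs hε (s - c)).comp_sub_const s c).deriv

theorem deriv_softSign_sub (c : ℝ) :
    deriv (fun s => softSign ε (s - c)) = fun s => softDelta ε (s - c) := by
  funext s
  exact ((hasDerivAt_softSign hε (s - c)).comp_sub_const s c).deriv

theorem contDiff_softAbs_sub (c : ℝ) : ContDiff ℝ 2 fun s => softAbs ε (s - c) := by
  unfold softAbs
  exact ContDiff.sqrt (by fun_prop) fun s => (sq_add_sq_pos hε _).ne'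

theorem convexOn_softAbs_sub (c : ℝ) : ConvexOn ℝ univ fun s => softAbs ε (s - c) := by
  refine convexOn_univ_of_deriv2_nonneg
    ((contDiff_softAbs_sub hε c).differentiable (by norm_num)) ?_ ?_
  · rw [deriv_softAbs_sub hε]
    exact fun s => ((hasDerivAt_softSign hε (s - c)).comp_sub_const s c).differentiableAt
  · intro s
    rw [Function.iterate_succ, Function.iterate_one, Function.comp, deriv_softAbs_sub hε,
      deriv_softSign_sub hε]
    exact softDelta_nonneg hε _

theorem abs_softSign_le (s : ℝ) : |softSign ε s| ≤ 1 := by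
  have h := sq_add_sq_pos hε s
  unfold softSign
  rw [abs_div, abs_of_pos (Real.sqrt_pos.2 h)]
  refine div_le_one_of_le₀ ?_ (Real.sqrt_nonneg _)
  rw [← Real.sqrt_sq_eq_abs]
  exact Real.sqrt_le_sqrt (by nlinarith)

theorem softAbs_le (s : ℝ) : |softAbs ε s| ≤ |s| + ε := by
  unfold softAbs
  rw [abs_of_nonneg (Real.sqrt_nonneg _)]
  refine Real.sqrt_le_iff.2 ⟨by positivity, ?_⟩
  have := abs_nonneg s
  nlinarith [sq_abs s]

end SoftAbs

theorem softAbs_sub_comm (ε a b : ℝ) : softAbs ε (a - b) = softAbs ε (b - a) := by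
  unfold softAbs; congr 1; ring

theorem softDelta_sub_comm (ε a b : ℝ) : softDelta ε (a - b) = softDelta ε (b - a) := by
  unfold softDelta
  rw [show (a - b) ^ 2 = (b - a) ^ 2 by ring]

theorem tendsto_softAbs (s : ℝ) : Tendsto (fun ε => softAbs ε s) (𝓝[>] 0) (𝓝 |s|) := by
  have h : Continuous fun ε => softAbs ε s := by unfold softAbs; fun_prop
  have := (h.tendsto 0).mono_left (nhdsWithin_le_nhds (s := Ioi 0))
  simpa [softAbs, Real.sqrt_sq_eq_abs] using this

theorem tendsto_softSign (s : ℝ) :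
    Tendsto (fun ε => softSign ε s) (𝓝[>] 0) (𝓝 (Real.sign s)) := by
  rcases eq_or_ne s 0 with rfl | hs
  · simp [softSign]
  · have h := (tendsto_const_nhds (x := s)).div (tendsto_softAbs s) (abs_ne_zero.2 hs)
    have h1 : Real.sign s = s / |s| := ?_
    · rw [h1]; exact h
    rcases lt_or_gt_of_ne hs with h | h
    · rw [Real.sign_of_neg h, abs_of_neg h]; field_simp
    · rw [Real.sign_of_pos h, abs_of_pos h]; field_simp

/-! ### Integrals of kernels with moving base point -/

/-- The integral `∫_b^a F(b, s) ds`. -/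
noncomputable def baseInt (F : ℝ → ℝ → ℝ) (a b : ℝ) : ℝ := ∫ s in b..a, F b s

theorem baseInt_eq {F : ℝ → ℝ → ℝ} (hF : Continuous (Function.uncurry F)) (a b : ℝ) :
    baseInt F a b = primitive (F b) a - primitive (F b) b := by
  have h : Continuous (F b) := by fun_prop
  exact (intervalIntegral.integral_interval_sub_left (h.intervalIntegrable _ _)
    (h.intervalIntegrable _ _)).symm

theorem continuous_baseInt {F : ℝ → ℝ → ℝ} (hF : Continuous (Function.uncurry F)) :
    Continuous (Function.uncurry (baseInt F)) := by
  have : Function.uncurry (baseInt F) =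
      fun p : ℝ × ℝ => (∫ s in (0 : ℝ)..p.1, F p.2 s) - ∫ s in (0 : ℝ)..p.2, F p.2 s := by
    funext p; exact baseInt_eq hF p.1 p.2
  rw [this]
  refine Continuous.sub ?_ ?_
  · exact intervalIntegral.continuous_parametric_intervalIntegral_of_continuous
      (f := fun (p : ℝ × ℝ) s => F p.2 s) (by fun_prop) continuous_fst
  · exact intervalIntegral.continuous_parametric_intervalIntegral_of_continuous
      (f := fun (p : ℝ × ℝ) s => F p.2 s) (by fun_prop) continuous_snd

theorem uIoc_subset_Icc_of_abs_le {M a b : ℝ} (ha : |a| ≤ M) (hb : |b| ≤ M) :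
    uIoc b a ⊆ Icc (-M) M :=
  uIoc_subset_uIcc.trans (uIcc_subset_Icc (abs_le.1 hb) (abs_le.1 ha))

theorem abs_baseInt_le {F : ℝ → ℝ → ℝ} {M K a b : ℝ} (hK : ∀ s, |s| ≤ M → |F b s| ≤ K)
    (ha : |a| ≤ M) (hb : |b| ≤ M) : |baseInt F a b| ≤ K * (2 * M) := by
  have hK0 : 0 ≤ K := (abs_nonneg _).trans (hK b hb)
  have h : ∀ s ∈ uIoc b a, ‖F b s‖ ≤ K := fun s hs =>
    hK s (abs_le.2 (uIoc_subset_Icc_of_abs_le ha hb hs))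
  refine (intervalIntegral.norm_integral_le_of_norm_le_const h).trans ?_
  refine mul_le_mul_of_nonneg_left ?_ hK0
  exact (abs_sub _ _).trans (by linarith)

/-- The entropy flux kernel `sgn(a - b) ∫_b^a k`. -/
noncomputable def signInt (k : ℝ → ℝ) (a b : ℝ) : ℝ := Real.sign (a - b) * ∫ s in b..a, k s

theorem signInt_comm (k : ℝ → ℝ) (a b : ℝ) : signInt k a b = signInt k b a := by
  unfold signInt
  rw [intervalIntegral.integral_symm, ← neg_sub b a, Real.sign_neg]; ring

theorem ae_sign_sub_eq (a b : ℝ) :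
    ∀ᵐ s : ℝ, s ∈ uIoc b a → Real.sign (s - b) = Real.sign (a - b) := by
  have h : ∀ᵐ s : ℝ, s ≠ b := by simp [ae_iff]
  filter_upwards [h] with s hs hsab
  rcases mem_uIoc.1 hsab with ⟨h1, h2⟩ | ⟨h1, h2⟩
  · rw [Real.sign_of_pos (by linarith), Real.sign_of_pos (by linarith)]
  · have : s < b := lt_of_le_of_ne h2 hs
    rw [Real.sign_of_neg (by linarith), Real.sign_of_neg (by linarith)]

theorem tendsto_baseInt_softSign {k : ℝ → ℝ} (hk : Continuous k) (a b : ℝ) :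
    Tendsto (fun ε => baseInt (fun b s => softSign ε (s - b) * k s) a b) (𝓝[>] 0)
      (𝓝 (signInt k a b)) := by
  unfold signInt baseInt
  rw [← intervalIntegral.integral_const_mul]
  refine intervalIntegral.tendsto_integral_filter_of_dominated_convergence (fun s => |k s|)
    ?_ ?_ (hk.abs.intervalIntegrable _ _) ?_
  · filter_upwards [self_mem_nhdsWithin] with ε hε
    have := continuous_softSign hε
    exact Continuous.aestronglyMeasurable (by fun_prop)
  · filter_upwards [self_mem_nhdsWithin] with ε hε
    refine Eventually.of_forall fun s _ => ?_
    rw [norm_mul, Real.norm_eq_abs, Real.norm_eq_abs]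
    exact mul_le_of_le_one_left (abs_nonneg _) (abs_softSign_le hε _)
  · filter_upwards [ae_sign_sub_eq a b] with s hs hsab
    rw [← hs hsab]
    exact (tendsto_softSign _).mul_const _

/-- Integration by parts for `∫_b^a η''(s - b) k(s) ds`. -/
theorem baseInt_softDelta {ε : ℝ} (hε : 0 < ε) {k : ℝ → ℝ} (hk : ContDiff ℝ ∞ k) (a b : ℝ) :
    baseInt (fun b s => softDelta ε (s - b) * k s) a b =
      softSign ε (a - b) * k a - baseInt (fun b s => softSign ε (s - b) * deriv k s) a b := by
  have h1 := continuous_softDelta hε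
  have h2 : Continuous (deriv k) := hk.continuous_deriv (by simp)
  have := intervalIntegral.integral_deriv_mul_eq_sub
    (u := fun s => softSign ε (s - b)) (u' := fun s => softDelta ε (s - b)) (v := k)
    (v' := deriv k) (a := b) (b := a)
    (fun s _ => (hasDerivAt_softSign hε (s - b)).comp_sub_const s b)
    (fun s _ => (hk.differentiable (by simp) s).hasDerivAt)
    (Continuous.intervalIntegrable (by fun_prop) _ _)
    (Continuous.intervalIntegrable (by fun_prop) _ _)
  have h3 := continuous_softSign hε
  have h4 := hk.continuous
  rw [intervalIntegral.integral_add (Continuous.intervalIntegrable (by fun_prop) _ _)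
    (Continuous.intervalIntegrable (by fun_prop) _ _)] at this
  unfold baseInt
  rw [eq_sub_iff_add_eq, this]
  simp [softSign]

/-- `softDelta ε` concentrates at 0 with total mass 2. An interval starting at the base point b sees
one half of it, hence mass 1 with the sign of a - b. The proof integrates by parts first, so that
only bounded kernels pass to the limit. -/
theorem tendsto_baseInt_softDelta {k : ℝ → ℝ} (hk : ContDiff ℝ ∞ k) (a b : ℝ) :
    Tendsto (fun ε => baseInt (fun b s => softDelta ε (s - b) * k s) a b) (𝓝[>] 0)
      (𝓝 (Real.sign (a - b) * k b)) := by
  have h2 : Continuous (deriv k) := hk.continuous_deriv (by simp)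
  have h := ((tendsto_softSign (a - b)).mul_const (k a)).sub (tendsto_baseInt_softSign h2 a b)
  have h3 : Real.sign (a - b) * k a - signInt (deriv k) a b = Real.sign (a - b) * k b := by
    unfold signInt
    rw [intervalIntegral.integral_deriv_eq_sub
      (fun s _ => hk.differentiable (by simp) s) (h2.intervalIntegrable _ _)]
    ring
  rw [h3] at h
  refine h.congr' ?_
  filter_upwards [self_mem_nhdsWithin] with ε hε
  exact (baseInt_softDelta hε hk a b).symm

theorem exists_bound_of_continuous {k : ℝ → ℝ} (hk : Continuous k) (M : ℝ) :
    ∃ K, 0 ≤ K ∧ ∀ s, |s| ≤ M → |k s| ≤ K := by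
  obtain ⟨K, hK⟩ := (isCompact_Icc (a := -M) (b := M)).exists_bound_of_continuousOn
    hk.continuousOn
  exact ⟨max K 0, le_max_right _ _, fun s hs => (hK s (abs_le.1 hs)).trans (le_max_left _ _)⟩

theorem abs_baseInt_softSign_le {k : ℝ → ℝ} (hk : Continuous k) (M : ℝ) :
    ∃ K, 0 ≤ K ∧ ∀ ε, 0 < ε → ∀ a b, |a| ≤ M → |b| ≤ M →
      |baseInt (fun b s => softSign ε (s - b) * k s) a b| ≤ K := by
  obtain ⟨K, hK0, hK⟩ := exists_bound_of_continuous hk M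
  -- No sign is assumed on M; |M| keeps the constant nonnegative even when there are no admissible a
  -- and b.
  refine ⟨K * (2 * |M|), by positivity, fun ε hε a b ha hb => ?_⟩
  rw [abs_of_nonneg ((abs_nonneg a).trans ha)]
  refine abs_baseInt_le (fun s hs => ?_) ha hb
  rw [abs_mul]
  exact (mul_le_of_le_one_left (abs_nonneg _) (abs_softSign_le hε _)).trans (hK s hs)

/-- `softDelta ε` has height 1/ε, so no pointwise bound is uniform in ε. Integration by parts trades
it for `softSign ε`, bounded by 1, at the price of a derivative of k; this uses the smoothness of σ.
-/
theorem abs_baseInt_softDelta_le {k : ℝ → ℝ} (hk : ContDiff ℝ ∞ k) (M : ℝ) :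
    ∃ K, 0 ≤ K ∧ ∀ ε, 0 < ε → ∀ a b, |a| ≤ M → |b| ≤ M →
      |baseInt (fun b s => softDelta ε (s - b) * k s) a b| ≤ K := by
  obtain ⟨K, hK0, hK⟩ := exists_bound_of_continuous hk.continuous M
  obtain ⟨K', hK0', hK'⟩ := abs_baseInt_softSign_le (hk.continuous_deriv (by simp)) M
  refine ⟨K + K', by positivity, fun ε hε a b ha hb => ?_⟩
  rw [baseInt_softDelta hε hk]
  refine (abs_sub _ _).trans (add_le_add ?_ (hK' ε hε a b ha hb))
  rw [abs_mul]
  exact (mul_le_of_le_one_left (abs_nonneg _) (abs_softSign_le hε _)).trans (hK a ha)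

/-- The kernel `∫_b^a (∫_ζ^a η''(ξ - ζ) k(ξ) dξ) l(ζ) dζ` of the mixed dissipation term, with
the opposite sign. -/
noncomputable def crossInt (ε : ℝ) (k l : ℝ → ℝ) (a b : ℝ) : ℝ :=
  baseInt (fun a ζ => baseInt (fun b s => softDelta ε (s - b) * k s) a ζ * l ζ) b a

theorem continuous_uncurry_softDelta {ε : ℝ} (hε : 0 < ε) {k : ℝ → ℝ} (hk : Continuous k) :
    Continuous (Function.uncurry fun b s => softDelta ε (s - b) * k s) := by
  have := continuous_softDelta hε
  unfold Function.uncurry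
  fun_prop

theorem continuous_uncurry_softSign {ε : ℝ} (hε : 0 < ε) {k : ℝ → ℝ} (hk : Continuous k) :
    Continuous (Function.uncurry fun b s => softSign ε (s - b) * k s) := by
  have := continuous_softSign hε
  unfold Function.uncurry
  fun_prop

theorem continuous_uncurry_crossInt_integrand {ε : ℝ} (hε : 0 < ε) {k l : ℝ → ℝ}
    (hk : Continuous k) (hl : Continuous l) :
    Continuous (Function.uncurry fun a ζ =>
      baseInt (fun b s => softDelta ε (s - b) * k s) a ζ * l ζ) :=
  (continuous_baseInt (continuous_uncurry_softDelta hε hk)).mul (hl.comp continuous_snd)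

theorem continuous_crossInt {ε : ℝ} (hε : 0 < ε) {k l : ℝ → ℝ}
    (hk : Continuous k) (hl : Continuous l) :
    Continuous (Function.uncurry (crossInt ε k l)) :=
  (continuous_baseInt (continuous_uncurry_crossInt_integrand hε hk hl)).comp continuous_swap

theorem abs_crossInt_le {k l : ℝ → ℝ} (hk : ContDiff ℝ ∞ k) (hl : Continuous l) (M : ℝ) :
    ∃ K, 0 ≤ K ∧ ∀ ε, 0 < ε → ∀ a b, |a| ≤ M → |b| ≤ M → |crossInt ε k l a b| ≤ K := by
  obtain ⟨K, hK0, hK⟩ := exists_bound_of_continuous hl M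
  obtain ⟨K', hK0', hK'⟩ := abs_baseInt_softDelta_le hk M
  refine ⟨K' * K * (2 * |M|), by positivity, fun ε hε a b ha hb => ?_⟩
  rw [abs_of_nonneg ((abs_nonneg a).trans ha)]
  refine abs_baseInt_le (fun s hs => ?_) hb ha
  rw [abs_mul]
  exact mul_le_mul (hK' ε hε a s ha hs) (hK s hs) (abs_nonneg _) hK0'

/-- The inner integral tends to sgn(a - ζ) k(ζ), and sgn(a - ζ) = sgn(a - b) for almost every ζ
between a and b. The outer integral runs from a to b, while `signInt` integrates from b to a: hence
the minus sign. -/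
theorem tendsto_crossInt {k l : ℝ → ℝ} (hk : ContDiff ℝ ∞ k) (hl : Continuous l) (a b : ℝ) :
    Tendsto (fun ε => crossInt ε k l a b) (𝓝[>] 0)
      (𝓝 (-signInt (fun s => k s * l s) a b)) := by
  set M := max |a| |b|
  obtain ⟨K', hK0', hK'⟩ := abs_baseInt_softDelta_le hk M
  have h0 : -signInt (fun s => k s * l s) a b =
      ∫ s in a..b, Real.sign (a - b) * (k s * l s) := by
    rw [intervalIntegral.integral_const_mul, signInt, intervalIntegral.integral_symm]
    ring
  rw [h0]
  unfold crossInt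
  refine intervalIntegral.tendsto_integral_filter_of_dominated_convergence
    (fun s => K' * |l s|) ?_ ?_ ((continuous_const.mul hl.abs).intervalIntegrable _ _) ?_
  · filter_upwards [self_mem_nhdsWithin] with ε hε
    have := continuous_uncurry_crossInt_integrand hε hk.continuous hl
    exact Continuous.aestronglyMeasurable
      (this.comp (f := fun s : ℝ => (a, s)) (by fun_prop))
  · filter_upwards [self_mem_nhdsWithin] with ε hε
    refine Eventually.of_forall fun s hs => ?_
    rw [norm_mul, Real.norm_eq_abs, Real.norm_eq_abs]
    refine mul_le_mul_of_nonneg_right (hK' ε hε a s (le_max_left _ _) ?_) (abs_nonneg _)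
    exact abs_le.2 (uIoc_subset_Icc_of_abs_le (M := M) (le_max_right _ _) (le_max_left _ _) hs)
  · filter_upwards [ae_sign_sub_eq b a] with s hs hsab
    have h1 := (tendsto_baseInt_softDelta hk a s).mul_const (l s)
    have h2 : Real.sign (a - s) = Real.sign (a - b) := by
      rw [← neg_sub, Real.sign_neg, hs hsab, ← Real.sign_neg, neg_sub]
    rw [h2, mul_assoc] at h1
    exact h1

end DegenerateParabolic

namespace DegenerateParabolic

/-- Space-time `ℝ × ℝ^d`. -/
abbrev SpaceTime (d : ℕ) := ℝ × (Fin d → ℝ)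

/-- Lebesgue measure on the half space `(0, ∞) × ℝ^d`. -/
noncomputable abbrev halfVol (d : ℕ) : Measure (SpaceTime d) := volume.restrict (halfSpace d)

/-- The unit vector in the time direction. -/
def tvec (d : ℕ) : SpaceTime d := (1, 0)

/-- The `i`-th unit vector in space. -/
def xvec {d : ℕ} (i : Fin d) : SpaceTime d := (0, Pi.single i 1)

variable {d : ℕ}

instance : (volume : Measure (SpaceTime d)).IsAddHaarMeasure :=
  inferInstanceAs ((volume : Measure ℝ).prod (volume : Measure (Fin d → ℝ))).IsAddHaarMeasure

theorem measurableSet_halfSpace : MeasurableSet (halfSpace d) :=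
  measurableSet_Ioi.prod MeasurableSet.univ

theorem isOpen_halfSpace : IsOpen (halfSpace d) := isOpen_Ioi.prod isOpen_univ

/-! ### Directional derivatives of test functions -/

theorem contDiff_fderiv_apply {V : Type*} [NormedAddCommGroup V] [NormedSpace ℝ V]
    {φ : V → ℝ} (h : ContDiff ℝ ∞ φ) (e : V) : ContDiff ℝ ∞ fun z => fderiv ℝ φ z e :=
  (h.fderiv_right (m := ∞) (by simp)).clm_apply contDiff_const

theorem IsTestFunction.fderiv_apply {φ : SpaceTime d → ℝ} (h : IsTestFunction φ)
    (e : SpaceTime d) : IsTestFunction fun z => fderiv ℝ φ z e where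
  smooth := contDiff_fderiv_apply h.smooth e
  compact := h.compact.fderiv_apply ℝ e
  supp := (tsupport_fderiv_apply_subset ℝ e).trans h.supp

theorem IsTestFunction.eq_zero {φ : SpaceTime d → ℝ} (h : IsTestFunction φ) {z : SpaceTime d}
    (hz : z ∉ halfSpace d) : φ z = 0 :=
  image_eq_zero_of_notMem_tsupport fun h' => hz (h.supp h')

theorem IsTestFunction.integral_fderiv_apply {φ : SpaceTime d → ℝ} (h : IsTestFunction φ)
    (e : SpaceTime d) : ∫ z in halfSpace d, fderiv ℝ φ z e = 0 := by
  have h' := h.fderiv_apply e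
  rw [setIntegral_eq_integral_of_forall_compl_eq_zero fun z hz => h'.eq_zero hz]
  have := integral_mul_fderiv_eq_neg_fderiv_mul_of_integrable (μ := volume) (f := fun _ => (1 : ℝ))
    (g := φ) (v := e) (by simp)
    (by simpa using h'.smooth.continuous.integrable_of_hasCompactSupport h'.compact)
    (by simpa using h.smooth.continuous.integrable_of_hasCompactSupport h.compact)
    (fun _ _ => differentiableAt_const _) (fun _ _ => h.smooth.differentiable (by simp) _)
  simpa using this

/-- Test functions of two space-time variables. -/
structure IsDoubleTest (Φ : SpaceTime d × SpaceTime d → ℝ) : Prop where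
  smooth : ContDiff ℝ ∞ Φ
  compact : HasCompactSupport Φ
  supp : tsupport Φ ⊆ halfSpace d ×ˢ halfSpace d

namespace IsDoubleTest

variable {Φ : SpaceTime d × SpaceTime d → ℝ}

theorem fderiv_apply (h : IsDoubleTest Φ) (e : SpaceTime d × SpaceTime d) :
    IsDoubleTest fun z => fderiv ℝ Φ z e where
  smooth := contDiff_fderiv_apply h.smooth e
  compact := h.compact.fderiv_apply ℝ e
  supp := (tsupport_fderiv_apply_subset ℝ e).trans h.supp

theorem left (h : IsDoubleTest Φ) (w : SpaceTime d) : IsTestFunction fun z => Φ (z, w) := by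
  have hsub : tsupport (fun z => Φ (z, w)) ⊆ (fun z => (z, w)) ⁻¹' tsupport Φ :=
    closure_minimal (fun z hz => subset_tsupport Φ hz)
      ((isClosed_tsupport Φ).preimage (by fun_prop))
  refine ⟨h.smooth.comp (by fun_prop), ?_, fun z hz => (h.supp (hsub hz)).1⟩
  exact (h.compact.isCompact.image continuous_fst).of_isClosed_subset (isClosed_tsupport _)
    fun z hz => ⟨_, hsub hz, rfl⟩

theorem right (h : IsDoubleTest Φ) (z : SpaceTime d) : IsTestFunction fun w => Φ (z, w) := by
  have hsub : tsupport (fun w => Φ (z, w)) ⊆ (fun w => (z, w)) ⁻¹' tsupport Φ :=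
    closure_minimal (fun z hz => subset_tsupport Φ hz)
      ((isClosed_tsupport Φ).preimage (by fun_prop))
  refine ⟨h.smooth.comp (by fun_prop), ?_, fun z hz => (h.supp (hsub hz)).2⟩
  exact (h.compact.isCompact.image continuous_snd).of_isClosed_subset (isClosed_tsupport _)
    fun z hz => ⟨_, hsub hz, rfl⟩

theorem fderiv_left (h : IsDoubleTest Φ) (w e : SpaceTime d) :
    (fun z => fderiv ℝ (fun z => Φ (z, w)) z e) = fun z => fderiv ℝ Φ (z, w) (e, 0) := by
  funext z
  have h1 := (h.smooth.differentiable (by simp) (z, w)).hasFDerivAt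
  have h2 := HasFDerivAt.comp (f := fun z => (z, w)) z h1 (hasFDerivAt_prodMk_left z w)
  have h3 := h2.fderiv
  simp only [Function.comp_def] at h3
  rw [h3]
  simp

theorem fderiv_right (h : IsDoubleTest Φ) (z e : SpaceTime d) :
    (fun w => fderiv ℝ (fun w => Φ (z, w)) w e) = fun w => fderiv ℝ Φ (z, w) (0, e) := by
  funext w
  have h1 := (h.smooth.differentiable (by simp) (z, w)).hasFDerivAt
  have h2 := HasFDerivAt.comp (f := fun w => (z, w)) w h1 (hasFDerivAt_prodMk_right z w)
  have h3 := h2.fderiv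
  simp only [Function.comp_def] at h3
  rw [h3]
  simp

end IsDoubleTest

/-! ### Regular representatives of entropy solutions -/

/-- An entropy solution with Borel, everywhere bounded representatives. -/
structure IsRegularSolution (f : Fin d → ℝ → ℝ) (A σ : Fin d → Fin d → ℝ → ℝ) (M : ℝ)
    (u : SpaceTime d → ℝ) (g : Fin d → SpaceTime d → ℝ) : Prop where
  measurable : Measurable u
  abs_le : ∀ z, |u z| ≤ M
  measurable_g : ∀ k, Measurable (g k)
  integrableOn_sq : ∀ k K, IsCompact K → IntegrableOn (fun z => g k z ^ 2) K (halfVol d)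
  chain : ∀ ψ : ℝ → ℝ, Continuous ψ → ∀ k,
    HasWeakDiv (fun i z => primitive (fun s => ψ s * σ i k s) (u z)) fun z => ψ (u z) * g k z
  entropy : ∀ η : ℝ → ℝ, ContDiff ℝ 2 η → ConvexOn ℝ univ η → EntropyInequality f A u g η

theorem IsRegularSolution.mono {f : Fin d → ℝ → ℝ} {A σ : Fin d → Fin d → ℝ → ℝ} {M M' : ℝ}
    {u : SpaceTime d → ℝ} {g : Fin d → SpaceTime d → ℝ} (h : IsRegularSolution f A σ M u g)
    (hM : M ≤ M') : IsRegularSolution f A σ M' u g :=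
  { h with abs_le := fun z => (h.abs_le z).trans hM }

theorem cube_mono {R R' : ℝ} (h : R ≤ R') : cube d R ⊆ cube d R' :=
  fun _ hx i => (hx i).trans (by linarith)

theorem exists_subset_cube {K : Set (SpaceTime d)} (hK : IsCompact K) :
    ∃ R, 0 < R ∧ K ∩ halfSpace d ⊆ Ioi 0 ×ˢ cube d R := by
  obtain ⟨C, hC⟩ := hK.exists_bound_of_continuousOn (f := fun z : SpaceTime d => z.2)
    (by fun_prop)
  refine ⟨2 * max C 1, by positivity, fun z hz => ⟨hz.2.1, fun i => ?_⟩⟩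
  have := (norm_le_pi_norm z.2 i).trans (hC z hz.1)
  rw [Real.norm_eq_abs] at this
  have h2 := le_max_left C 1
  linarith

/-- Countably many of the sets (0, ∞) × I_R exhaust the half space. -/
theorem MemL2Cubes.aestronglyMeasurable {g : SpaceTime d → ℝ} (h : MemL2Cubes g) :
    AEStronglyMeasurable g (halfVol d) := by
  have : halfSpace d = ⋃ n : ℕ, Ioi (0 : ℝ) ×ˢ cube d (n + 1 : ℝ) := by
    ext z
    refine ⟨fun hz => ?_, fun hz => ?_⟩
    · obtain ⟨R, hR, hsub⟩ := exists_subset_cube (isCompact_singleton (x := z))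
      obtain ⟨n, hn⟩ := exists_nat_ge R
      have h1 := hsub ⟨rfl, hz⟩
      exact mem_iUnion.2 ⟨n, h1.1, cube_mono (by linarith) h1.2⟩
    · obtain ⟨n, hn⟩ := mem_iUnion.1 hz
      exact ⟨hn.1, trivial⟩
  rw [halfVol, this]
  exact AEStronglyMeasurable.iUnion fun n => (h _ (by positivity)).aestronglyMeasurable

theorem IsEntropySolution.exists_regular {f : Fin d → ℝ → ℝ} {A σ : Fin d → Fin d → ℝ → ℝ}
    {u₀ : (Fin d → ℝ) → ℝ} {u : SpaceTime d → ℝ} (h : IsEntropySolution f A σ u₀ u) :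
    ∃ M U g, IsRegularSolution f A σ M U g ∧ u =ᵐ[halfVol d] U := by
  obtain ⟨g, hg1, hg2, hg3⟩ := h.interior
  have hum := h.memLp.aestronglyMeasurable
  set M := (eLpNormEssSup u (halfVol d)).toReal
  have hfin : eLpNormEssSup u (halfVol d) ≠ ⊤ := by
    have := h.memLp.2
    rw [eLpNorm_exponent_top] at this
    exact this.ne
  have hM : ∀ᵐ z ∂halfVol d, |u z| ≤ M := by
    filter_upwards [ae_le_eLpNormEssSup (f := u) (μ := halfVol d)] with z hz
    have := ENNReal.toReal_mono hfin hz
    simpa using this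
  have hM0 : 0 ≤ M := ENNReal.toReal_nonneg
  -- Truncating a Borel representative at the essential supremum does not change its class, and
  -- makes the bound valid everywhere. Thus v(w) may be frozen at every w, not only at almost every
  -- w.
  set U : SpaceTime d → ℝ := fun z => max (-M) (min M (hum.mk u z))
  have hU : u =ᵐ[halfVol d] U := by
    filter_upwards [hM, hum.ae_eq_mk] with z h1 h2
    simp only [U, ← h2]
    rw [min_eq_right (abs_le.1 h1).2, max_eq_right (abs_le.1 h1).1]
  have hgm := fun k => (hg1 k).1.aestronglyMeasurable
  set G : Fin d → SpaceTime d → ℝ := fun k => (hgm k).mk (g k)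
  have hG : ∀ᵐ z ∂halfVol d, ∀ k, g k z = G k z := ae_all_iff.2 fun k => (hgm k).ae_eq_mk
  refine ⟨M, U, G, ⟨?_, ?_, ?_, ?_, ?_, ?_⟩, hU⟩
  · exact measurable_const.max (measurable_const.min hum.stronglyMeasurable_mk.measurable)
  · intro z
    exact abs_le.2 ⟨le_max_left _ _, max_le (by linarith) (min_le_left _ _)⟩
  · exact fun k => (hgm k).stronglyMeasurable_mk.measurable
  · intro k K hK
    obtain ⟨R, hR, hsub⟩ := exists_subset_cube hK
    have h1 : IntegrableOn (fun z => g k z ^ 2) (K ∩ halfSpace d) volume :=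
      (((hg1 k).1 R hR).integrable_sq).mono_measure (Measure.restrict_mono hsub le_rfl)
    rw [IntegrableOn, halfVol, Measure.restrict_restrict hK.measurableSet]
    refine Integrable.congr h1 ?_
    have h2 : ∀ᵐ z ∂volume.restrict (K ∩ halfSpace d), ∀ k, g k z = G k z :=
      ae_mono (Measure.restrict_mono inter_subset_right le_rfl) hG
    filter_upwards [h2] with z hz
    rw [hz]
  · intro ψ hψ k φ hφ
    have := (hg2 ψ hψ k).2 φ hφ
    convert this using 1
    · refine integral_congr_ae ?_
      filter_upwards [hU] with z hz
      rw [hz]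
    · congr 1
      refine integral_congr_ae ?_
      filter_upwards [hU, hG] with z hz hz'
      rw [hz, hz']
  · intro η h1 h2 φ hφ hφ0
    have := hg3 η h1 h2 φ hφ hφ0
    convert this using 1
    · refine integral_congr_ae ?_
      filter_upwards [hU, hG] with z hz hz'
      simp only [hz, hz']
    · refine integral_congr_ae ?_
      filter_upwards [hU] with z hz
      simp only [hz]

/-! ### Entropy inequality and chain rule with moving constants -/

theorem integrable_comp_mul {u χ : SpaceTime d → ℝ} {M : ℝ} (hu : Measurable u)
    (hM : ∀ z, |u z| ≤ M) {G : ℝ → ℝ} (hG : Continuous G) (hχ : Continuous χ)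
    (hχc : HasCompactSupport χ) : Integrable (fun z => G (u z) * χ z) (halfVol d) := by
  obtain ⟨K, -, hK⟩ := exists_bound_of_continuous hG M
  exact (hχ.integrable_of_hasCompactSupport hχc).restrict.bdd_mul (c := K)
    (hG.measurable.comp hu).aestronglyMeasurable
    (Eventually.of_forall fun z => hK _ (hM z))

namespace IsRegularSolution

variable {f : Fin d → ℝ → ℝ} {A σ : Fin d → Fin d → ℝ → ℝ} {M : ℝ}
  {u v : SpaceTime d → ℝ} {g h : Fin d → SpaceTime d → ℝ}

/-- Derivatives of test functions have integral zero, so constants may be subtracted from the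
primitives. In the doubling argument this moves their base point from 0 to the frozen value of the
other solution. -/
theorem chain_sub (hu : IsRegularSolution f A σ M u g) (hσ : ∀ i k, Continuous (σ i k))
    {ψ : ℝ → ℝ} (hψ : Continuous ψ)
    (k : Fin d) (c : Fin d → ℝ) {φ : SpaceTime d → ℝ} (hφ : IsTestFunction φ) :
    ∫ z in halfSpace d, ∑ i, (primitive (fun s => ψ s * σ i k s) (u z) - c i) *
      fderiv ℝ φ z (xvec i) = -∫ z in halfSpace d, ψ (u z) * g k z * φ z := by
  rw [← hu.chain ψ hψ k φ hφ]
  have hφ' := fun i => hφ.fderiv_apply (xvec i)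
  have hint : ∀ i, Integrable (fun z => primitive (fun s => ψ s * σ i k s) (u z) *
      fderiv ℝ φ z (xvec i)) (halfVol d) := fun i => by
    have : Continuous (primitive fun s => ψ s * σ i k s) :=
      intervalIntegral.continuous_primitive
        (fun a b => Continuous.intervalIntegrable (by fun_prop) a b) 0
    exact integrable_comp_mul hu.measurable hu.abs_le this (hφ' i).smooth.continuous
      (hφ' i).compact
  have hint2 : ∀ i, Integrable (fun z => c i * fderiv ℝ φ z (xvec i)) (halfVol d) := fun i =>
    ((hφ' i).smooth.continuous.integrable_of_hasCompactSupport (hφ' i).compact).restrict.const_mul _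
  have : ∀ i, ∫ z in halfSpace d, (primitive (fun s => ψ s * σ i k s) (u z) - c i) *
      fderiv ℝ φ z (xvec i) =
      ∫ z in halfSpace d, primitive (fun s => ψ s * σ i k s) (u z) * fderiv ℝ φ z (xvec i) := by
    intro i
    simp_rw [sub_mul]
    rw [integral_sub (hint i) (hint2 i), integral_const_mul, hφ.integral_fderiv_apply, mul_zero,
      sub_zero]
  rw [integral_finsetSum, integral_finsetSum]
  · exact Finset.sum_congr rfl fun i _ => this i
  · exact fun i _ => hint i
  · intro i _
    simp_rw [sub_mul]
    exact (hint i).sub (hint2 i)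

end IsRegularSolution

/-- The entropy flux `∫_b^a η'(s - b) k(s) ds` for `η = softAbs ε`. -/
noncomputable def softInt (ε : ℝ) (k : ℝ → ℝ) (a b : ℝ) : ℝ :=
  baseInt (fun b s => softSign ε (s - b) * k s) a b

theorem continuous_softInt {ε : ℝ} (hε : 0 < ε) {k : ℝ → ℝ} (hk : Continuous k) :
    Continuous (Function.uncurry (softInt ε k)) :=
  continuous_baseInt (continuous_uncurry_softSign hε hk)

/-- The fluxes are normalized to vanish at u = c, so that their limits as ε → 0 are symmetric in u
and c. The discarded constants, collected in `R`, multiply derivatives of φ and integrate to zero.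
-/
theorem IsRegularSolution.entropy_softAbs {f : Fin d → ℝ → ℝ} {A σ : Fin d → Fin d → ℝ → ℝ}
    {M : ℝ} {u : SpaceTime d → ℝ} {g : Fin d → SpaceTime d → ℝ}
    (hu : IsRegularSolution f A σ M u g) (hdata : IsData f A σ) {ε : ℝ} (hε : 0 < ε) (c : ℝ)
    {φ : SpaceTime d → ℝ} (hφ : IsTestFunction φ) (hφ0 : ∀ z, 0 ≤ φ z) :
    ∫ z in halfSpace d, softDelta ε (u z - c) * (∑ k, g k z ^ 2) * φ z ≤
      ∫ z in halfSpace d, (softAbs ε (u z - c) * fderiv ℝ φ z (tvec d)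
        + ∑ i, softInt ε (deriv (f i)) (u z) c * fderiv ℝ φ z (xvec i)
        + ∑ i, ∑ j, softInt ε (deriv (A i j)) (u z) c *
            fderiv ℝ (fun z => fderiv ℝ φ z (xvec j)) z (xvec i)) := by
  have hE := hu.entropy _ (contDiff_softAbs_sub hε c) (convexOn_softAbs_sub hε c) φ hφ hφ0
  rw [deriv_softAbs_sub hε, deriv_softSign_sub hε] at hE
  refine hE.trans (le_of_eq ?_)
  have hf : ∀ i, Continuous (deriv (f i)) := fun i => (hdata.smooth_f i).continuous_deriv (by simp)
  have hA : ∀ i j, Continuous (deriv (A i j)) :=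
    fun i j => (hdata.smooth_A i j).continuous_deriv (by simp)
  have hφ1 := fun i => hφ.fderiv_apply (xvec i)
  have hφ2 := fun i j => (hφ1 j).fderiv_apply (xvec i)
  have hφt := hφ.fderiv_apply (tvec d)
  set R : SpaceTime d → ℝ := fun z =>
    (∑ i, primitive (fun s => softSign ε (s - c) * deriv (f i) s) c * fderiv ℝ φ z (xvec i)) +
    ∑ i, ∑ j, primitive (fun s => softSign ε (s - c) * deriv (A i j) s) c *
      fderiv ℝ (fun z => fderiv ℝ φ z (xvec j)) z (xvec i)
  have i1 : ∀ (a : ℝ) i, Integrable (fun z => a * fderiv ℝ φ z (xvec i)) (halfVol d) := fun a i =>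
    ((hφ1 i).smooth.continuous.integrable_of_hasCompactSupport (hφ1 i).compact).restrict.const_mul _
  have i2 : ∀ (a : ℝ) i j, Integrable (fun z => a *
      fderiv ℝ (fun z => fderiv ℝ φ z (xvec j)) z (xvec i)) (halfVol d) := fun a i j =>
    ((hφ2 i j).smooth.continuous.integrable_of_hasCompactSupport
      (hφ2 i j).compact).restrict.const_mul _
  have hRi1 := integrable_finsetSum (μ := halfVol d) Finset.univ fun i _ =>
    i1 (primitive (fun s => softSign ε (s - c) * deriv (f i) s) c) i
  have hRi2 := integrable_finsetSum (μ := halfVol d) Finset.univ fun i _ =>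
    integrable_finsetSum (μ := halfVol d) Finset.univ fun j _ =>
    i2 (primitive (fun s => softSign ε (s - c) * deriv (A i j) s) c) i j
  have hRi : Integrable R (halfVol d) := hRi1.add hRi2
  have hR0 : ∫ z in halfSpace d, R z = 0 := by
    simp only [R]
    rw [integral_add hRi1 hRi2, integral_finsetSum _ fun i _ => i1 _ i,
      integral_finsetSum _ fun i _ => integrable_finsetSum _ fun j _ => i2 _ i j]
    have : ∀ i, ∫ z in halfSpace d, ∑ j,
        primitive (fun s => softSign ε (s - c) * deriv (A i j) s) c *
        fderiv ℝ (fun z => fderiv ℝ φ z (xvec j)) z (xvec i) = 0 := fun i => by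
      rw [integral_finsetSum _ fun j _ => i2 _ i j]
      simp [integral_const_mul, (hφ1 _).integral_fderiv_apply]
    simp [this, integral_const_mul, hφ.integral_fderiv_apply]
  have hcs := continuous_softSign hε
  have hca := continuous_softAbs hε
  have cs : ∀ k, Continuous k → Continuous fun a => softInt ε k a c := fun k hk =>
    (continuous_softInt hε hk).comp (f := fun a : ℝ => (a, c)) (by fun_prop)
  have key : ∀ k, Continuous k → ∀ a, primitive (fun s => softSign ε (s - c) * k s) a =
      softInt ε k a c + primitive (fun s => softSign ε (s - c) * k s) c := fun k hk a => by
    rw [softInt, baseInt_eq (continuous_uncurry_softSign hε hk)]; ring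
  have hint : Integrable (fun z => softAbs ε (u z - c) * fderiv ℝ φ z (tvec d)
        + ∑ i, softInt ε (deriv (f i)) (u z) c * fderiv ℝ φ z (xvec i)
        + ∑ i, ∑ j, softInt ε (deriv (A i j)) (u z) c *
            fderiv ℝ (fun z => fderiv ℝ φ z (xvec j)) z (xvec i)) (halfVol d) := by
    refine ((integrable_comp_mul hu.measurable hu.abs_le (G := fun a => softAbs ε (a - c))
      (by fun_prop) hφt.smooth.continuous hφt.compact).add
      (integrable_finsetSum _ fun i _ => ?_)).add
      (integrable_finsetSum _ fun i _ => integrable_finsetSum _ fun j _ => ?_)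
    · exact integrable_comp_mul hu.measurable hu.abs_le (cs _ (hf i)) (hφ1 i).smooth.continuous
        (hφ1 i).compact
    · exact integrable_comp_mul hu.measurable hu.abs_le (cs _ (hA i j))
        (hφ2 i j).smooth.continuous (hφ2 i j).compact
  refine Eq.trans ?_ ((integral_add hint hRi).trans (by rw [hR0, add_zero]))
  congr 1
  funext z
  have e1 : ∀ i, primitive (fun s => softSign ε (s - c) * deriv (f i) s) (u z) * dx i φ z =
      softInt ε (deriv (f i)) (u z) c * fderiv ℝ φ z (xvec i) +
      primitive (fun s => softSign ε (s - c) * deriv (f i) s) c * fderiv ℝ φ z (xvec i) :=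
    fun i => by rw [key _ (hf i), add_mul]; rfl
  have e2 : ∀ i j, primitive (fun s => softSign ε (s - c) * deriv (A i j) s) (u z) *
      dx i (dx j φ) z =
      softInt ε (deriv (A i j)) (u z) c * fderiv ℝ (fun z => fderiv ℝ φ z (xvec j)) z (xvec i) +
      primitive (fun s => softSign ε (s - c) * deriv (A i j) s) c *
        fderiv ℝ (fun z => fderiv ℝ φ z (xvec j)) z (xvec i) :=
    fun i j => by rw [key _ (hA i j), add_mul]; rfl
  simp only [R, e1, e2, Finset.sum_add_distrib]
  change softAbs ε (u z - c) * fderiv ℝ φ z (tvec d) + _ + _ = _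
  ring

end DegenerateParabolic

namespace DegenerateParabolic

variable {d : ℕ}

/-! ### Doubling of variables at a fixed regularization parameter -/

theorem integrableOn_one {K : Set (SpaceTime d)} (hK : IsCompact K) :
    IntegrableOn (fun _ => (1 : ℝ)) K (halfVol d) :=
  integrableOn_const (hK.measure_lt_top).ne

/-- The support of χ lies in the product of its two compact projections, where a(z) b(w) is
integrable as a product; the remaining factors are bounded. -/
theorem integrable_double {u v : SpaceTime d → ℝ} {M : ℝ} (hu : Measurable u)
    (hv : Measurable v) (huM : ∀ z, |u z| ≤ M) (hvM : ∀ z, |v z| ≤ M) {G : ℝ → ℝ → ℝ}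
    (hG : Continuous (Function.uncurry G)) {χ : SpaceTime d × SpaceTime d → ℝ}
    (hχ : Continuous χ) (hχc : HasCompactSupport χ) {a b : SpaceTime d → ℝ}
    (ha : ∀ K, IsCompact K → IntegrableOn a K (halfVol d))
    (hb : ∀ K, IsCompact K → IntegrableOn b K (halfVol d)) :
    Integrable (fun p => G (u p.1) (v p.2) * (a p.1 * b p.2) * χ p)
      ((halfVol d).prod (halfVol d)) := by
  have hK1 : IsCompact (Prod.fst '' tsupport χ) := hχc.isCompact.image continuous_fst
  have hK2 : IsCompact (Prod.snd '' tsupport χ) := hχc.isCompact.image continuous_snd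
  have h1 := ((integrable_indicator_iff hK1.measurableSet).2 (ha _ hK1)).mul_prod
    ((integrable_indicator_iff hK2.measurableSet).2 (hb _ hK2))
  obtain ⟨C, hC⟩ := hχc.exists_bound_of_continuous hχ
  obtain ⟨K, hK⟩ := ((isCompact_Icc (a := -M) (b := M)).prod
    (isCompact_Icc (a := -M) (b := M))).exists_bound_of_continuousOn hG.continuousOn
  have h2 := h1.bdd_mul (c := K * C) (f := fun p => G (u p.1) (v p.2) * χ p)
    (Measurable.aestronglyMeasurable ?_) (Eventually.of_forall fun p => ?_)
  · refine h2.congr (Eventually.of_forall fun p => ?_)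
    simp only
    by_cases hp : p ∈ tsupport χ
    · rw [indicator_of_mem (mem_image_of_mem Prod.fst hp),
        indicator_of_mem (mem_image_of_mem Prod.snd hp)]
      ring
    · rw [image_eq_zero_of_notMem_tsupport hp]; ring
  · refine Measurable.mul ?_ hχ.measurable
    exact hG.measurable.comp ((hu.comp measurable_fst).prodMk (hv.comp measurable_snd))
  · rw [norm_mul]
    have h3 := hK (u p.1, v p.2) ⟨abs_le.1 (huM _), abs_le.1 (hvM _)⟩
    exact mul_le_mul h3 (hC p) (norm_nonneg _) ((norm_nonneg _).trans h3)

theorem integral_prod_le_of_left {X Y : SpaceTime d × SpaceTime d → ℝ}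
    (hX : Integrable X ((halfVol d).prod (halfVol d)))
    (hY : Integrable Y ((halfVol d).prod (halfVol d)))
    (h : ∀ w, ∫ z in halfSpace d, X (z, w) ≤ ∫ z in halfSpace d, Y (z, w)) :
    ∫ p, X p ∂((halfVol d).prod (halfVol d)) ≤ ∫ p, Y p ∂((halfVol d).prod (halfVol d)) := by
  rw [integral_prod_symm _ hX, integral_prod_symm _ hY]
  exact integral_mono hX.integral_prod_right hY.integral_prod_right h

theorem integral_prod_le_of_right {X Y : SpaceTime d × SpaceTime d → ℝ}
    (hX : Integrable X ((halfVol d).prod (halfVol d)))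
    (hY : Integrable Y ((halfVol d).prod (halfVol d)))
    (h : ∀ z, ∫ w in halfSpace d, X (z, w) ≤ ∫ w in halfSpace d, Y (z, w)) :
    ∫ p, X p ∂((halfVol d).prod (halfVol d)) ≤ ∫ p, Y p ∂((halfVol d).prod (halfVol d)) := by
  rw [integral_prod _ hX, integral_prod _ hY]
  exact integral_mono hX.integral_prod_left hY.integral_prod_left h

theorem integral_prod_eq_of_left {X Y : SpaceTime d × SpaceTime d → ℝ}
    (hX : Integrable X ((halfVol d).prod (halfVol d)))
    (hY : Integrable Y ((halfVol d).prod (halfVol d)))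
    (h : ∀ w, ∫ z in halfSpace d, X (z, w) = ∫ z in halfSpace d, Y (z, w)) :
    ∫ p, X p ∂((halfVol d).prod (halfVol d)) = ∫ p, Y p ∂((halfVol d).prod (halfVol d)) :=
  le_antisymm (integral_prod_le_of_left hX hY fun w => (h w).le)
    (integral_prod_le_of_left hY hX fun w => (h w).ge)

theorem integral_prod_eq_of_right {X Y : SpaceTime d × SpaceTime d → ℝ}
    (hX : Integrable X ((halfVol d).prod (halfVol d)))
    (hY : Integrable Y ((halfVol d).prod (halfVol d)))
    (h : ∀ z, ∫ w in halfSpace d, X (z, w) = ∫ w in halfSpace d, Y (z, w)) :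
    ∫ p, X p ∂((halfVol d).prod (halfVol d)) = ∫ p, Y p ∂((halfVol d).prod (halfVol d)) :=
  le_antisymm (integral_prod_le_of_right hX hY fun w => (h w).le)
    (integral_prod_le_of_right hY hX fun w => (h w).ge)

namespace IsRegularSolution

variable {f : Fin d → ℝ → ℝ} {A σ : Fin d → Fin d → ℝ → ℝ} {M : ℝ}
  {u v : SpaceTime d → ℝ} {g h : Fin d → SpaceTime d → ℝ}
  {Φ : SpaceTime d × SpaceTime d → ℝ} {ε : ℝ}

theorem integrableOn_g (hu : IsRegularSolution f A σ M u g) (k : Fin d)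
    {K : Set (SpaceTime d)} (hK : IsCompact K) : IntegrableOn (g k) K (halfVol d) := by
  have h1 := (integrableOn_one hK).add (hu.integrableOn_sq k K hK)
  refine Integrable.mono' h1 (hu.measurable_g k).aestronglyMeasurable
    (Eventually.of_forall fun z => ?_)
  simp only [Pi.add_apply]
  rw [Real.norm_eq_abs]
  nlinarith [sq_nonneg (|g k z| - 1), sq_abs (g k z), sq_nonneg (|g k z|)]

theorem integrable_term (hu : IsRegularSolution f A σ M u g) (hv : IsRegularSolution f A σ M v h)
    {G : ℝ → ℝ → ℝ} (hG : Continuous (Function.uncurry G)) (hΦ : IsDoubleTest Φ) :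
    Integrable (fun p => G (u p.1) (v p.2) * Φ p) ((halfVol d).prod (halfVol d)) := by
  simpa using integrable_double hu.measurable hv.measurable hu.abs_le hv.abs_le hG
    hΦ.smooth.continuous hΦ.compact (fun K hK => integrableOn_one hK)
    (fun K hK => integrableOn_one hK)

/-- The mixed dissipation term, after two applications of the chain rule. -/
theorem integral_mixed (hu : IsRegularSolution f A σ M u g) (hv : IsRegularSolution f A σ M v h)
    (hdata : IsData f A σ) (hε : 0 < ε) (hΦ : IsDoubleTest Φ) (k : Fin d) :
    ∫ p, softDelta ε (u p.1 - v p.2) * (g k p.1 * h k p.2) * Φ p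
        ∂((halfVol d).prod (halfVol d)) =
      ∫ p, ∑ i, ∑ j, crossInt ε (σ i k) (σ j k) (u p.1) (v p.2) *
        fderiv ℝ (fun p => fderiv ℝ Φ p (xvec i, 0)) p (0, xvec j)
        ∂((halfVol d).prod (halfVol d)) := by
  have hσ := fun i k => (hdata.smooth_σ i k).continuous
  have hd := continuous_softDelta hε
  have hB := fun i => continuous_baseInt (continuous_uncurry_softDelta hε (hσ i k))
  have hΦ1 := fun i : Fin d => hΦ.fderiv_apply (xvec i, 0)
  have hΦ2 := fun i j : Fin d => (hΦ1 i).fderiv_apply (0, xvec j)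
  have int1 : ∀ i, Integrable (fun p : SpaceTime d × SpaceTime d =>
      baseInt (fun b s => softDelta ε (s - b) * σ i k s) (u p.1) (v p.2) * (1 * h k p.2) *
        fderiv ℝ Φ p (xvec i, 0)) ((halfVol d).prod (halfVol d)) := fun i =>
    integrable_double hu.measurable hv.measurable hu.abs_le hv.abs_le (hB i)
      (hΦ1 i).smooth.continuous (hΦ1 i).compact (fun K hK => integrableOn_one hK)
      (fun K hK => hv.integrableOn_g k hK)
  have int2 : ∀ i, Integrable (fun p : SpaceTime d × SpaceTime d =>
      ∑ j, crossInt ε (σ i k) (σ j k) (u p.1) (v p.2) *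
        fderiv ℝ (fun p => fderiv ℝ Φ p (xvec i, 0)) p (0, xvec j))
        ((halfVol d).prod (halfVol d)) := fun i =>
    integrable_finsetSum _ fun j _ =>
      hu.integrable_term hv (continuous_crossInt hε (hσ i k) (hσ j k)) (hΦ2 i j)
  -- With w frozen, h_k(w) is a constant and the chain rule for u is used with ψ = η''(· - v(w)).
  have step1 : ∫ p, softDelta ε (u p.1 - v p.2) * (g k p.1 * h k p.2) * Φ p
        ∂((halfVol d).prod (halfVol d)) =
      ∫ p, -∑ i, baseInt (fun b s => softDelta ε (s - b) * σ i k s) (u p.1) (v p.2) *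
        (1 * h k p.2) * fderiv ℝ Φ p (xvec i, 0) ∂((halfVol d).prod (halfVol d)) := by
    refine integral_prod_eq_of_left ?_ ?_ fun w => ?_
    · exact integrable_double hu.measurable hv.measurable hu.abs_le hv.abs_le
        (G := fun a b => softDelta ε (a - b)) (by unfold Function.uncurry; fun_prop)
        hΦ.smooth.continuous hΦ.compact (fun K hK => hu.integrableOn_g k hK)
        (fun K hK => hv.integrableOn_g k hK)
    · exact (integrable_finsetSum _ fun i _ => int1 i).neg
    · have := hu.chain_sub hσ (ψ := fun s => softDelta ε (s - v w)) (by fun_prop) k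
        (fun i => primitive (fun s => softDelta ε (s - v w) * σ i k s) (v w)) (hΦ.left w)
      have e1 : ∀ z, softDelta ε (u z - v w) * (g k z * h k w) * Φ (z, w) =
        h k w * (softDelta ε (u z - v w) * g k z * Φ (z, w)) := fun z => by ring
      have e2 : ∀ z, -∑ i, baseInt (fun b s => softDelta ε (s - b) * σ i k s) (u z) (v w) *
        (1 * h k w) * fderiv ℝ Φ (z, w) (xvec i, 0) =
        -h k w * ∑ i, (primitive (fun s => softDelta ε (s - v w) * σ i k s) (u z) -
          primitive (fun s => softDelta ε (s - v w) * σ i k s) (v w)) *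
          fderiv ℝ (fun z => Φ (z, w)) z (xvec i) := fun z => by
        rw [neg_mul, Finset.mul_sum]
        congr 1
        refine Finset.sum_congr rfl fun i _ => ?_
        rw [baseInt_eq (continuous_uncurry_softDelta hε (hσ i k)),
          congrFun (hΦ.fderiv_left w (xvec i)) z]
        ring
      simp_rw [e1, e2]
      rw [integral_const_mul, integral_const_mul, this]
      ring
  -- With z frozen, the kernel produced by the first step is a continuous function of v(w). It
  -- serves as ψ in the chain rule for v, with primitives based at u(z). The two integrations by
  -- parts give two signs, which cancel.
  have step2 : ∀ i, ∫ p, -(baseInt (fun b s => softDelta ε (s - b) * σ i k s) (u p.1) (v p.2) *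
        (1 * h k p.2) * fderiv ℝ Φ p (xvec i, 0)) ∂((halfVol d).prod (halfVol d)) =
      ∫ p, ∑ j, crossInt ε (σ i k) (σ j k) (u p.1) (v p.2) *
        fderiv ℝ (fun p => fderiv ℝ Φ p (xvec i, 0)) p (0, xvec j)
        ∂((halfVol d).prod (halfVol d)) := by
    intro i
    refine integral_prod_eq_of_right (int1 i).neg (int2 i) fun z => ?_
    have hc := fun j => continuous_uncurry_crossInt_integrand hε (hσ i k) (hσ j k)
    have := hv.chain_sub hσ
      (ψ := fun ζ => baseInt (fun b s => softDelta ε (s - b) * σ i k s) (u z) ζ)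
      ((hB i).comp (f := fun ζ : ℝ => (u z, ζ)) (by fun_prop)) k
      (fun j => primitive (fun ζ =>
        baseInt (fun b s => softDelta ε (s - b) * σ i k s) (u z) ζ * σ j k ζ) (u z))
      ((hΦ1 i).right z)
    have e2 : ∀ w, ∑ j, crossInt ε (σ i k) (σ j k) (u z) (v w) *
        fderiv ℝ (fun p => fderiv ℝ Φ p (xvec i, 0)) (z, w) (0, xvec j) =
        ∑ j, (primitive (fun ζ =>
        baseInt (fun b s => softDelta ε (s - b) * σ i k s) (u z) ζ * σ j k ζ) (v w) -
        primitive (fun ζ =>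
        baseInt (fun b s => softDelta ε (s - b) * σ i k s) (u z) ζ * σ j k ζ) (u z)) *
        fderiv ℝ (fun w => fderiv ℝ Φ (z, w) (xvec i, 0)) w (xvec j) := fun w => by
      refine Finset.sum_congr rfl fun j _ => ?_
      rw [crossInt, baseInt_eq (hc j), congrFun ((hΦ1 i).fderiv_right z (xvec j)) w]
    simp_rw [e2]
    rw [this, integral_neg]
    simp_rw [one_mul]
  rw [step1, integral_finsetSum _ fun i _ => int2 i]
  simp_rw [← Finset.sum_neg_distrib]
  refine (integral_finsetSum _ fun i _ => (int1 i).neg).trans ?_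
  exact Finset.sum_congr rfl fun i _ => step2 i

/-- The right-hand side of the doubled entropy inequality for the entropy `softAbs ε`. -/
noncomputable def doubledIntegrand (f : Fin d → ℝ → ℝ) (A σ : Fin d → Fin d → ℝ → ℝ)
    (u v : SpaceTime d → ℝ) (Φ : SpaceTime d × SpaceTime d → ℝ) (ε : ℝ)
    (p : SpaceTime d × SpaceTime d) : ℝ :=
  (softAbs ε (u p.1 - v p.2) * fderiv ℝ Φ p (tvec d, 0)
    + ∑ i, softInt ε (deriv (f i)) (u p.1) (v p.2) * fderiv ℝ Φ p (xvec i, 0)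
    + ∑ i, ∑ j, softInt ε (deriv (A i j)) (u p.1) (v p.2) *
        fderiv ℝ (fun p => fderiv ℝ Φ p (xvec j, 0)) p (xvec i, 0))
  + (softAbs ε (u p.1 - v p.2) * fderiv ℝ Φ p (0, tvec d)
    + ∑ i, softInt ε (deriv (f i)) (v p.2) (u p.1) * fderiv ℝ Φ p (0, xvec i)
    + ∑ i, ∑ j, softInt ε (deriv (A i j)) (v p.2) (u p.1) *
        fderiv ℝ (fun p => fderiv ℝ Φ p (0, xvec j)) p (0, xvec i))
  - 2 * ∑ k, ∑ i, ∑ j, crossInt ε (σ i k) (σ j k) (u p.1) (v p.2) *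
        fderiv ℝ (fun p => fderiv ℝ Φ p (xvec i, 0)) p (0, xvec j)

theorem doubled_nonneg (hu : IsRegularSolution f A σ M u g) (hv : IsRegularSolution f A σ M v h)
    (hdata : IsData f A σ) (hε : 0 < ε) (hΦ : IsDoubleTest Φ) (hΦ0 : ∀ p, 0 ≤ Φ p) :
    0 ≤ ∫ p, doubledIntegrand f A σ u v Φ ε p ∂((halfVol d).prod (halfVol d)) := by
  have hσ := fun i k => (hdata.smooth_σ i k).continuous
  have hf : ∀ i, Continuous (deriv (f i)) := fun i => (hdata.smooth_f i).continuous_deriv (by simp)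
  have hA : ∀ i j, Continuous (deriv (A i j)) :=
    fun i j => (hdata.smooth_A i j).continuous_deriv (by simp)
  have hd := continuous_softDelta hε
  have hab := continuous_softAbs hε
  have hd2 : Continuous (Function.uncurry fun a b => softDelta ε (a - b)) := by
    unfold Function.uncurry; fun_prop
  have hab2 : Continuous (Function.uncurry fun a b => softAbs ε (a - b)) := by
    unfold Function.uncurry; fun_prop
  have hΦl := fun i : Fin d => hΦ.fderiv_apply (xvec i, 0)
  have hΦr := fun i : Fin d => hΦ.fderiv_apply (0, xvec i)
  have sw : ∀ {k : ℝ → ℝ}, Continuous k →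
      Continuous (Function.uncurry fun a b => softInt ε k b a) := fun hk =>
    (continuous_softInt hε hk).comp continuous_swap
  set Y₁ : SpaceTime d × SpaceTime d → ℝ := fun p =>
    softAbs ε (u p.1 - v p.2) * fderiv ℝ Φ p (tvec d, 0)
    + ∑ i, softInt ε (deriv (f i)) (u p.1) (v p.2) * fderiv ℝ Φ p (xvec i, 0)
    + ∑ i, ∑ j, softInt ε (deriv (A i j)) (u p.1) (v p.2) *
        fderiv ℝ (fun p => fderiv ℝ Φ p (xvec j, 0)) p (xvec i, 0)
  set Y₂ : SpaceTime d × SpaceTime d → ℝ := fun p =>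
    softAbs ε (u p.1 - v p.2) * fderiv ℝ Φ p (0, tvec d)
    + ∑ i, softInt ε (deriv (f i)) (v p.2) (u p.1) * fderiv ℝ Φ p (0, xvec i)
    + ∑ i, ∑ j, softInt ε (deriv (A i j)) (v p.2) (u p.1) *
        fderiv ℝ (fun p => fderiv ℝ Φ p (0, xvec j)) p (0, xvec i)
  set Y₃ : Fin d → SpaceTime d × SpaceTime d → ℝ := fun k p =>
    ∑ i, ∑ j, crossInt ε (σ i k) (σ j k) (u p.1) (v p.2) *
        fderiv ℝ (fun p => fderiv ℝ Φ p (xvec i, 0)) p (0, xvec j)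
  have hY₁ : Integrable Y₁ ((halfVol d).prod (halfVol d)) :=
    ((hu.integrable_term hv hab2 (hΦ.fderiv_apply _)).add
      (integrable_finsetSum _ fun i _ =>
        hu.integrable_term hv (continuous_softInt hε (hf i)) (hΦl i))).add
      (integrable_finsetSum _ fun i _ => integrable_finsetSum _ fun j _ =>
        hu.integrable_term hv (continuous_softInt hε (hA i j)) ((hΦl j).fderiv_apply _))
  have hY₂ : Integrable Y₂ ((halfVol d).prod (halfVol d)) :=
    ((hu.integrable_term hv hab2 (hΦ.fderiv_apply _)).add
      (integrable_finsetSum _ fun i _ =>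
        hu.integrable_term hv (sw (hf i)) (hΦr i))).add
      (integrable_finsetSum _ fun i _ => integrable_finsetSum _ fun j _ =>
        hu.integrable_term hv (sw (hA i j)) ((hΦr j).fderiv_apply _))
  have hY₃ : ∀ k, Integrable (Y₃ k) ((halfVol d).prod (halfVol d)) := fun k =>
    integrable_finsetSum _ fun i _ => integrable_finsetSum _ fun j _ =>
        hu.integrable_term hv (continuous_crossInt hε (hσ i k) (hσ j k))
          ((hΦl i).fderiv_apply _)
  set X₁ : SpaceTime d × SpaceTime d → ℝ := fun p =>
    softDelta ε (u p.1 - v p.2) * (∑ k, g k p.1 ^ 2) * Φ p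
  set X₂ : SpaceTime d × SpaceTime d → ℝ := fun p =>
    softDelta ε (u p.1 - v p.2) * (∑ k, h k p.2 ^ 2) * Φ p
  set X₃ : Fin d → SpaceTime d × SpaceTime d → ℝ := fun k p =>
    softDelta ε (u p.1 - v p.2) * (g k p.1 * h k p.2) * Φ p
  have hX₁ : Integrable X₁ ((halfVol d).prod (halfVol d)) := by
    simpa [X₁] using integrable_double hu.measurable hv.measurable hu.abs_le hv.abs_le hd2
      hΦ.smooth.continuous hΦ.compact (a := fun z => ∑ k, g k z ^ 2) (b := fun _ => 1)
      (fun K hK => integrable_finsetSum _ fun k _ => hu.integrableOn_sq k K hK)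
      (fun K hK => integrableOn_one hK)
  have hX₂ : Integrable X₂ ((halfVol d).prod (halfVol d)) := by
    simpa [X₂] using integrable_double hu.measurable hv.measurable hu.abs_le hv.abs_le hd2
      hΦ.smooth.continuous hΦ.compact (b := fun z => ∑ k, h k z ^ 2) (a := fun _ => 1)
      (fun K hK => integrableOn_one hK)
      (fun K hK => integrable_finsetSum _ fun k _ => hv.integrableOn_sq k K hK)
  have hX₃ : ∀ k, Integrable (X₃ k) ((halfVol d).prod (halfVol d)) := fun k =>
    integrable_double hu.measurable hv.measurable hu.abs_le hv.abs_le hd2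
      hΦ.smooth.continuous hΦ.compact (fun K hK => hu.integrableOn_g k hK)
      (fun K hK => hv.integrableOn_g k hK)
  have le₁ : ∫ p, X₁ p ∂((halfVol d).prod (halfVol d)) ≤
      ∫ p, Y₁ p ∂((halfVol d).prod (halfVol d)) := by
    refine integral_prod_le_of_left hX₁ hY₁ fun w => ?_
    have := hu.entropy_softAbs hdata hε (v w) (hΦ.left w) (fun z => hΦ0 (z, w))
    simp only [fun z e => congrFun (hΦ.fderiv_left w e) z,
      fun j z e => congrFun ((hΦl j).fderiv_left w e) z] at this
    exact this
  have le₂ : ∫ p, X₂ p ∂((halfVol d).prod (halfVol d)) ≤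
      ∫ p, Y₂ p ∂((halfVol d).prod (halfVol d)) := by
    refine integral_prod_le_of_right hX₂ hY₂ fun z => ?_
    have := hv.entropy_softAbs hdata hε (u z) (hΦ.right z) (fun w => hΦ0 (z, w))
    simp only [fun w e => congrFun (hΦ.fderiv_right z e) w,
      fun j w e => congrFun ((hΦr j).fderiv_right z e) w,
      fun w => softDelta_sub_comm ε (v w) (u z), fun w => softAbs_sub_comm ε (v w) (u z)] at this
    exact this
  have eq₃ : ∫ p, ∑ k, X₃ k p ∂((halfVol d).prod (halfVol d)) =
      ∫ p, ∑ k, Y₃ k p ∂((halfVol d).prod (halfVol d)) := by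
    rw [integral_finsetSum _ fun k _ => hX₃ k, integral_finsetSum _ fun k _ => hY₃ k]
    exact Finset.sum_congr rfl fun k _ => hu.integral_mixed hv hdata hε hΦ k
  have hX₃s := integrable_finsetSum (μ := (halfVol d).prod (halfVol d)) Finset.univ
    fun k _ => hX₃ k
  have hY₃s := integrable_finsetSum (μ := (halfVol d).prod (halfVol d)) Finset.univ
    fun k _ => hY₃ k
  -- This is (g_k - h_k)² ≥ 0, weighted by η''(u - v) Φ ≥ 0.
  have cauchy : ∫ p, 2 * ∑ k, X₃ k p ∂((halfVol d).prod (halfVol d)) ≤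
      ∫ p, (X₁ p + X₂ p) ∂((halfVol d).prod (halfVol d)) := by
    refine integral_mono (hX₃s.const_mul 2) (hX₁.add hX₂) fun p => ?_
    simp only [X₁, X₂, X₃]
    rw [← Finset.sum_mul, ← Finset.mul_sum, ← add_mul, ← mul_add, ← mul_assoc,
      mul_left_comm (2 : ℝ), ← Finset.sum_add_distrib]
    refine mul_le_mul_of_nonneg_right (mul_le_mul_of_nonneg_left ?_ (softDelta_nonneg hε _))
      (hΦ0 p)
    rw [Finset.mul_sum]
    exact Finset.sum_le_sum fun k _ => by nlinarith [sq_nonneg (g k p.1 - h k p.2)]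
  rw [integral_const_mul, integral_add hX₁ hX₂, eq₃] at cauchy
  have : ∫ p, doubledIntegrand f A σ u v Φ ε p ∂((halfVol d).prod (halfVol d)) =
      ∫ p, Y₁ p ∂((halfVol d).prod (halfVol d)) + ∫ p, Y₂ p ∂((halfVol d).prod (halfVol d)) -
        2 * ∫ p, ∑ k, Y₃ k p ∂((halfVol d).prod (halfVol d)) := by
    rw [← integral_const_mul, ← integral_add hY₁ hY₂]
    exact integral_sub (hY₁.add hY₂) (hY₃s.const_mul 2)
  rw [this]
  linarith

end IsRegularSolution

end DegenerateParabolic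

namespace DegenerateParabolic

variable {d : ℕ}

/-! ### Removing the regularization of the entropy -/

/-- Dominated pointwise convergence of a family of functions as `ε → 0+`. -/
structure DominatedTendsto {α : Type*} [MeasurableSpace α] (μ : Measure α) (F : ℝ → α → ℝ)
    (L : α → ℝ) : Prop where
  measurable : ∀ᶠ ε in 𝓝[>] (0 : ℝ), AEStronglyMeasurable (F ε) μ
  bound : ∃ B : α → ℝ, Integrable B μ ∧ ∀ᶠ ε in 𝓝[>] (0 : ℝ), ∀ p, |F ε p| ≤ B p
  tendsto : ∀ p, Tendsto (fun ε => F ε p) (𝓝[>] 0) (𝓝 (L p))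

namespace DominatedTendsto

variable {α : Type*} [MeasurableSpace α] {μ : Measure α} {F F' : ℝ → α → ℝ} {L L' : α → ℝ}

theorem add (h : DominatedTendsto μ F L) (h' : DominatedTendsto μ F' L') :
    DominatedTendsto μ (fun ε p => F ε p + F' ε p) fun p => L p + L' p where
  measurable := by
    filter_upwards [h.measurable, h'.measurable] with ε h1 h2 using h1.add h2
  bound := by
    obtain ⟨B, hB, hF⟩ := h.bound
    obtain ⟨B', hB', hF'⟩ := h'.bound
    refine ⟨fun p => B p + B' p, hB.add hB', ?_⟩
    filter_upwards [hF, hF'] with ε h1 h2 p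
    exact (abs_add_le _ _).trans (add_le_add (h1 p) (h2 p))
  tendsto p := (h.tendsto p).add (h'.tendsto p)

theorem const_mul (h : DominatedTendsto μ F L) (c : ℝ) :
    DominatedTendsto μ (fun ε p => c * F ε p) fun p => c * L p where
  measurable := by filter_upwards [h.measurable] with ε h1 using h1.const_mul c
  bound := by
    obtain ⟨B, hB, hF⟩ := h.bound
    refine ⟨fun p => |c| * B p, hB.const_mul _, ?_⟩
    filter_upwards [hF] with ε h1 p
    rw [abs_mul]
    exact mul_le_mul_of_nonneg_left (h1 p) (abs_nonneg c)
  tendsto p := (h.tendsto p).const_mul c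

theorem sub (h : DominatedTendsto μ F L) (h' : DominatedTendsto μ F' L') :
    DominatedTendsto μ (fun ε p => F ε p - F' ε p) fun p => L p - L' p := by
  simpa [sub_eq_add_neg] using h.add (h'.const_mul (-1))

theorem sum {ι : Type*} [Fintype ι] {F : ι → ℝ → α → ℝ} {L : ι → α → ℝ}
    (h : ∀ i, DominatedTendsto μ (F i) (L i)) :
    DominatedTendsto μ (fun ε p => ∑ i, F i ε p) fun p => ∑ i, L i p where
  measurable := by
    filter_upwards [eventually_all.2 fun i => (h i).measurable] with ε h1
    exact Finset.aestronglyMeasurable_fun_sum _ fun i _ => h1 i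
  bound := by
    choose B hB hF using fun i => (h i).bound
    refine ⟨fun p => ∑ i, B i p, integrable_finsetSum _ fun i _ => hB i, ?_⟩
    filter_upwards [eventually_all.2 hF] with ε h1 p
    exact (Finset.abs_sum_le_sum_abs _ _).trans (Finset.sum_le_sum fun i _ => h1 i p)
  tendsto p := tendsto_finsetSum _ fun i _ => (h i).tendsto p

theorem tendsto_integral (h : DominatedTendsto μ F L) :
    Tendsto (fun ε => ∫ p, F ε p ∂μ) (𝓝[>] 0) (𝓝 (∫ p, L p ∂μ)) := by
  obtain ⟨B, hB, hF⟩ := h.bound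
  refine tendsto_integral_filter_of_dominated_convergence B h.measurable ?_ hB
    (Eventually.of_forall h.tendsto)
  filter_upwards [hF] with ε h1
  exact Eventually.of_forall h1

end DominatedTendsto

/-- The restriction ε < 1 serves the entropy itself, which is bounded through √(s² + ε²) ≤ |s| + ε;
the flux and cross kernels have bounds uniform in all ε > 0. -/
theorem DominatedTendsto.kernel {u v : SpaceTime d → ℝ} {M : ℝ} (hu : Measurable u)
    (hv : Measurable v) (huM : ∀ z, |u z| ≤ M) (hvM : ∀ z, |v z| ≤ M) {G : ℝ → ℝ → ℝ → ℝ}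
    {G₀ : ℝ → ℝ → ℝ} (hG : ∀ ε, 0 < ε → Continuous (Function.uncurry (G ε))) {K : ℝ}
    (hK : ∀ ε, 0 < ε → ε < 1 → ∀ a b, |a| ≤ M → |b| ≤ M → |G ε a b| ≤ K)
    (hlim : ∀ a b, Tendsto (fun ε => G ε a b) (𝓝[>] 0) (𝓝 (G₀ a b)))
    {Φ : SpaceTime d × SpaceTime d → ℝ} (hΦ : IsDoubleTest Φ) :
    DominatedTendsto ((halfVol d).prod (halfVol d)) (fun ε p => G ε (u p.1) (v p.2) * Φ p)
      fun p => G₀ (u p.1) (v p.2) * Φ p where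
  measurable := by
    filter_upwards [self_mem_nhdsWithin] with ε hε
    refine (Measurable.mul ?_ hΦ.smooth.continuous.measurable).aestronglyMeasurable
    exact (hG ε hε).measurable.comp ((hu.comp measurable_fst).prodMk (hv.comp measurable_snd))
  bound := by
    refine ⟨fun p => K * |Φ p|, ?_, ?_⟩
    · have := integrable_double hu hv huM hvM (G := fun _ _ => 1)
        (by unfold Function.uncurry; fun_prop)
        hΦ.smooth.continuous hΦ.compact (fun K hK => integrableOn_one hK)
        (fun K hK => integrableOn_one hK)
      simp only [one_mul] at this
      exact this.abs.const_mul K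
    · filter_upwards [self_mem_nhdsWithin, Ioo_mem_nhdsGT one_pos] with ε hε hε1 p
      rw [abs_mul]
      exact mul_le_mul_of_nonneg_right (hK ε hε hε1.2 _ _ (huM _) (hvM _)) (abs_nonneg _)
  tendsto p := (hlim _ _).mul_const _

theorem fderiv_fderiv_apply_comm {V : Type*} [NormedAddCommGroup V] [NormedSpace ℝ V]
    {φ : V → ℝ} (h : ContDiff ℝ ∞ φ) (a b p : V) :
    fderiv ℝ (fun p => fderiv ℝ φ p a) p b = fderiv ℝ (fun p => fderiv ℝ φ p b) p a := by
  have hd : DifferentiableAt ℝ (fderiv ℝ φ) p :=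
    (h.fderiv_right (m := ∞) (by simp)).differentiable (by simp) p
  have e : ∀ a b, fderiv ℝ (fun p => fderiv ℝ φ p a) p b = fderiv ℝ (fderiv ℝ φ) p b a := by
    intro a b
    rw [fderiv_clm_apply hd (differentiableAt_const a)]
    simp
  rw [e, e]
  exact (h.contDiffAt.isSymmSndFDerivAt (by simpa using WithTop.coe_le_coe.2 (le_top (a := (2 : ℕ∞))))).eq b a

theorem fderiv_fderiv_apply_add {V : Type*} [NormedAddCommGroup V] [NormedSpace ℝ V]
    {φ : V → ℝ} (h : ContDiff ℝ ∞ φ) (a a' b b' p : V) :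
    fderiv ℝ (fun p => fderiv ℝ φ p (a + a')) p (b + b') =
      fderiv ℝ (fun p => fderiv ℝ φ p a) p b + fderiv ℝ (fun p => fderiv ℝ φ p a) p b' +
      (fderiv ℝ (fun p => fderiv ℝ φ p a') p b + fderiv ℝ (fun p => fderiv ℝ φ p a') p b') := by
  have hd : DifferentiableAt ℝ (fderiv ℝ φ) p :=
    (h.fderiv_right (m := ∞) (by simp)).differentiable (by simp) p
  have e : ∀ a b, fderiv ℝ (fun p => fderiv ℝ φ p a) p b = fderiv ℝ (fderiv ℝ φ) p b a := by
    intro a b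
    rw [fderiv_clm_apply hd (differentiableAt_const a)]
    simp
  rw [e, e, e, e, e]
  simp only [map_add, add_apply]

namespace IsRegularSolution

variable {f : Fin d → ℝ → ℝ} {A σ : Fin d → Fin d → ℝ → ℝ} {M : ℝ}
  {u v : SpaceTime d → ℝ} {g h : Fin d → SpaceTime d → ℝ}
  {Φ : SpaceTime d × SpaceTime d → ℝ}

/-- The pointwise limit of `doubledIntegrand` as `ε → 0+`. -/
theorem dominatedTendsto_doubledIntegrand (hu : IsRegularSolution f A σ M u g)
    (hv : IsRegularSolution f A σ M v h) (hdata : IsData f A σ) (hΦ : IsDoubleTest Φ) :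
    DominatedTendsto ((halfVol d).prod (halfVol d)) (doubledIntegrand f A σ u v Φ) fun p =>
      (|u p.1 - v p.2| * fderiv ℝ Φ p (tvec d, 0)
        + ∑ i, signInt (deriv (f i)) (u p.1) (v p.2) * fderiv ℝ Φ p (xvec i, 0)
        + ∑ i, ∑ j, signInt (deriv (A i j)) (u p.1) (v p.2) *
            fderiv ℝ (fun p => fderiv ℝ Φ p (xvec j, 0)) p (xvec i, 0))
      + (|u p.1 - v p.2| * fderiv ℝ Φ p (0, tvec d)
        + ∑ i, signInt (deriv (f i)) (v p.2) (u p.1) * fderiv ℝ Φ p (0, xvec i)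
        + ∑ i, ∑ j, signInt (deriv (A i j)) (v p.2) (u p.1) *
            fderiv ℝ (fun p => fderiv ℝ Φ p (0, xvec j)) p (0, xvec i))
      - 2 * ∑ k, ∑ i, ∑ j, -signInt (fun s => σ i k s * σ j k s) (u p.1) (v p.2) *
            fderiv ℝ (fun p => fderiv ℝ Φ p (xvec i, 0)) p (0, xvec j) := by
  have hσ := fun i k => (hdata.smooth_σ i k).continuous
  have hf : ∀ i, Continuous (deriv (f i)) := fun i => (hdata.smooth_f i).continuous_deriv (by simp)
  have hA : ∀ i j, Continuous (deriv (A i j)) :=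
    fun i j => (hdata.smooth_A i j).continuous_deriv (by simp)
  have habs : ∀ {χ : SpaceTime d × SpaceTime d → ℝ}, IsDoubleTest χ →
      DominatedTendsto ((halfVol d).prod (halfVol d))
        (fun ε p => softAbs ε (u p.1 - v p.2) * χ p) fun p => |u p.1 - v p.2| * χ p := fun hχ =>
    DominatedTendsto.kernel hu.measurable hv.measurable hu.abs_le hv.abs_le
      (G := fun ε a b => softAbs ε (a - b)) (G₀ := fun a b => |a - b|) (K := M + M + 1)
      (fun ε hε => by have := continuous_softAbs hε; unfold Function.uncurry; fun_prop)
      (fun ε hε hε1 a b ha hb => (softAbs_le hε _).trans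
        (add_le_add ((abs_sub _ _).trans (add_le_add ha hb)) hε1.le))
      (fun a b => tendsto_softAbs _) hχ
  have hflux : ∀ {k : ℝ → ℝ} {χ : SpaceTime d × SpaceTime d → ℝ}, Continuous k →
      IsDoubleTest χ → DominatedTendsto ((halfVol d).prod (halfVol d))
        (fun ε p => softInt ε k (u p.1) (v p.2) * χ p)
        fun p => signInt k (u p.1) (v p.2) * χ p := fun hk hχ => by
    obtain ⟨K, -, hK⟩ := abs_baseInt_softSign_le hk M
    exact DominatedTendsto.kernel hu.measurable hv.measurable hu.abs_le hv.abs_le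
      (fun ε hε => continuous_softInt hε hk) (fun ε hε _ a b ha hb => hK ε hε a b ha hb)
      (fun a b => tendsto_baseInt_softSign hk a b) hχ
  have hflux' : ∀ {k : ℝ → ℝ} {χ : SpaceTime d × SpaceTime d → ℝ}, Continuous k →
      IsDoubleTest χ → DominatedTendsto ((halfVol d).prod (halfVol d))
        (fun ε p => softInt ε k (v p.2) (u p.1) * χ p)
        fun p => signInt k (v p.2) (u p.1) * χ p := fun {k} _ hk hχ => by
    obtain ⟨K, -, hK⟩ := abs_baseInt_softSign_le hk M
    exact DominatedTendsto.kernel hu.measurable hv.measurable hu.abs_le hv.abs_le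
      (G := fun ε a b => softInt ε k b a) (G₀ := fun a b => signInt k b a)
      (fun ε hε => (continuous_softInt hε hk).comp continuous_swap)
      (fun ε hε _ a b ha hb => hK ε hε b a hb ha)
      (fun a b => tendsto_baseInt_softSign hk b a) hχ
  have hcross : ∀ (i j k : Fin d) {χ : SpaceTime d × SpaceTime d → ℝ},
      IsDoubleTest χ → DominatedTendsto ((halfVol d).prod (halfVol d))
        (fun ε p => crossInt ε (σ i k) (σ j k) (u p.1) (v p.2) * χ p)
        fun p => -signInt (fun s => σ i k s * σ j k s) (u p.1) (v p.2) * χ p :=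
      fun i j k _ hχ => by
    obtain ⟨K, -, hK⟩ := abs_crossInt_le (hdata.smooth_σ i k) (hσ j k) M
    exact DominatedTendsto.kernel hu.measurable hv.measurable hu.abs_le hv.abs_le
      (G₀ := fun a b => -signInt (fun s => σ i k s * σ j k s) a b)
      (fun ε hε => continuous_crossInt hε (hσ i k) (hσ j k))
      (fun ε hε _ a b ha hb => hK ε hε a b ha hb)
      (fun a b => tendsto_crossInt (hdata.smooth_σ i k) (hσ j k) a b) hχ
  have hΦl := fun e : SpaceTime d => hΦ.fderiv_apply (e, 0)
  have hΦr := fun e : SpaceTime d => hΦ.fderiv_apply (0, e)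
  exact ((((habs (hΦl _)).add (.sum fun i => hflux (hf i) (hΦl _))).add
    (.sum fun i => .sum fun j => hflux (hA i j) ((hΦl _).fderiv_apply _))).add
    (((habs (hΦr _)).add (.sum fun i => hflux' (hf i) (hΦr _))).add
    (.sum fun i => .sum fun j => hflux' (hA i j) ((hΦr _).fderiv_apply _)))).sub
    (.const_mul (.sum fun k => .sum fun i => .sum fun j =>
      hcross i j k ((hΦl _).fderiv_apply _)) 2)

/-- Kruzhkov's inequality in doubled variables. -/
theorem doubled_kruzhkov (hu : IsRegularSolution f A σ M u g)
    (hv : IsRegularSolution f A σ M v h) (hdata : IsData f A σ) (hΦ : IsDoubleTest Φ)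
    (hΦ0 : ∀ p, 0 ≤ Φ p) :
    0 ≤ ∫ p, (|u p.1 - v p.2| * fderiv ℝ Φ p (tvec d, tvec d)
        + ∑ i, signInt (deriv (f i)) (u p.1) (v p.2) * fderiv ℝ Φ p (xvec i, xvec i)
        + ∑ i, ∑ j, signInt (deriv (A i j)) (u p.1) (v p.2) *
            fderiv ℝ (fun p => fderiv ℝ Φ p (xvec j, xvec j)) p (xvec i, xvec i))
      ∂((halfVol d).prod (halfVol d)) := by
  refine le_of_le_of_eq (ge_of_tendsto
    (hu.dominatedTendsto_doubledIntegrand hv hdata hΦ).tendsto_integral ?_) ?_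
  · filter_upwards [self_mem_nhdsWithin] with ε hε
    exact hu.doubled_nonneg hv hdata hε hΦ hΦ0
  congr 1
  funext p
  have split : ∀ e : SpaceTime d, ((e, e) : SpaceTime d × SpaceTime d) = (e, 0) + (0, e) :=
    fun e => by simp
  -- The factorization A' = σσᵀ enters here: the mixed dissipation terms, summed over k, are
  -- governed by the same kernel as the diffusion terms.
  have hS : ∀ i j, signInt (deriv (A i j)) (u p.1) (v p.2) =
      ∑ k, signInt (fun s => σ i k s * σ j k s) (u p.1) (v p.2) := by
    intro i j
    unfold signInt
    rw [← Finset.mul_sum, ← intervalIntegral.integral_finsetSum]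
    · congr 2
      funext s
      exact hdata.factor i j s
    · intro k _
      exact (((hdata.smooth_σ i k).continuous.mul
        (hdata.smooth_σ j k).continuous)).intervalIntegrable _ _
  have cross : ∑ k, ∑ i, ∑ j, -signInt (fun s => σ i k s * σ j k s) (u p.1) (v p.2) *
            fderiv ℝ (fun p => fderiv ℝ Φ p (xvec i, 0)) p (0, xvec j) =
      -∑ i, ∑ j, signInt (deriv (A i j)) (u p.1) (v p.2) *
        fderiv ℝ (fun p => fderiv ℝ Φ p (xvec i, 0)) p (0, xvec j) := by
    rw [Finset.sum_comm, ← Finset.sum_neg_distrib]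
    refine Finset.sum_congr rfl fun i _ => ?_
    rw [Finset.sum_comm, ← Finset.sum_neg_distrib]
    refine Finset.sum_congr rfl fun j _ => ?_
    rw [hS, Finset.sum_mul, ← Finset.sum_neg_distrib]
    exact Finset.sum_congr rfl fun k _ => neg_mul _ _
  -- By the symmetry of A, the two kinds of mixed derivatives ∂_{x_j}∂_{y_i} and ∂_{x_i}∂_{y_j}
  -- contribute equally, so together they match the factor 2 of the dissipation.
  have swap : ∑ i, ∑ j, signInt (deriv (A i j)) (u p.1) (v p.2) *
        fderiv ℝ (fun p => fderiv ℝ Φ p (xvec j, 0)) p (0, xvec i) =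
      ∑ i, ∑ j, signInt (deriv (A i j)) (u p.1) (v p.2) *
        fderiv ℝ (fun p => fderiv ℝ Φ p (xvec i, 0)) p (0, xvec j) := by
    rw [Finset.sum_comm]
    refine Finset.sum_congr rfl fun i _ => Finset.sum_congr rfl fun j _ => ?_
    rw [hdata.symm]
  have comm : ∀ i j : Fin d, fderiv ℝ (fun p => fderiv ℝ Φ p (0, xvec j)) p (xvec i, 0) =
      fderiv ℝ (fun p => fderiv ℝ Φ p (xvec i, 0)) p (0, xvec j) := fun i j =>
    fderiv_fderiv_apply_comm hΦ.smooth _ _ _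
  have first : ∀ e, fderiv ℝ Φ p (e, e) = fderiv ℝ Φ p (e, 0) + fderiv ℝ Φ p (0, e) :=
    fun e => by rw [split, map_add]
  have second : ∀ i j : Fin d, fderiv ℝ (fun p => fderiv ℝ Φ p (xvec j, xvec j)) p
      (xvec i, xvec i) = fderiv ℝ (fun p => fderiv ℝ Φ p (xvec j, 0)) p (xvec i, 0) +
        fderiv ℝ (fun p => fderiv ℝ Φ p (xvec j, 0)) p (0, xvec i) +
        (fderiv ℝ (fun p => fderiv ℝ Φ p (xvec i, 0)) p (0, xvec j) +
        fderiv ℝ (fun p => fderiv ℝ Φ p (0, xvec j)) p (0, xvec i)) := fun i j => by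
    rw [split, split, fderiv_fderiv_apply_add hΦ.smooth, comm]
  simp only [first, second, mul_add,
    Finset.sum_add_distrib, swap, cross, signInt_comm _ (v p.2) (u p.1)]
  ring

end IsRegularSolution

end DegenerateParabolic

namespace DegenerateParabolic

variable {d : ℕ}

/-! ### The entropy fluxes are Lipschitz -/

/-- This form has no sign function: it makes visible that the jump of sgn at a = b is cancelled by
the vanishing integral. -/
theorem signInt_eq {k : ℝ → ℝ} (hk : Continuous k) (a b : ℝ) :
    signInt k a b = primitive k (max a b) - primitive k (min a b) := by
  unfold signInt
  rcases lt_trichotomy a b with h | rfl | h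
  · rw [max_eq_right h.le, min_eq_left h.le, Real.sign_of_neg (by linarith),
      intervalIntegral.integral_symm]
    simp only [primitive, neg_mul, one_mul, neg_neg]
    exact (intervalIntegral.integral_interval_sub_left (hk.intervalIntegrable _ _)
      (hk.intervalIntegrable _ _)).symm
  · simp
  · rw [max_eq_left h.le, min_eq_right h.le, Real.sign_of_pos (by linarith), one_mul]
    exact (intervalIntegral.integral_interval_sub_left (hk.intervalIntegrable _ _)
      (hk.intervalIntegrable _ _)).symm

theorem continuous_primitive {k : ℝ → ℝ} (hk : Continuous k) : Continuous (primitive k) :=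
  intervalIntegral.continuous_primitive (fun a b => hk.intervalIntegrable a b) 0

theorem continuous_signInt {k : ℝ → ℝ} (hk : Continuous k) :
    Continuous (Function.uncurry (signInt k)) := by
  have : Function.uncurry (signInt k) =
      fun p : ℝ × ℝ => primitive k (max p.1 p.2) - primitive k (min p.1 p.2) := by
    funext p; exact signInt_eq hk p.1 p.2
  rw [this]
  have := continuous_primitive hk
  fun_prop

/-- Kernels that are continuous, and Lipschitz in the second variable on `[-M, M]`. -/
structure IsLipKernel (M : ℝ) (G : ℝ → ℝ → ℝ) : Prop where
  continuous : Continuous (Function.uncurry G)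
  lipschitz : ∃ L, 0 ≤ L ∧ ∀ a b b', |a| ≤ M → |b| ≤ M → |b'| ≤ M →
    |G a b - G a b'| ≤ L * |b - b'|

theorem IsLipKernel.bound {M : ℝ} {G : ℝ → ℝ → ℝ} (h : IsLipKernel M G) :
    ∃ C, 0 ≤ C ∧ ∀ a b, |a| ≤ M → |b| ≤ M → |G a b| ≤ C := by
  obtain ⟨K, hK⟩ := ((isCompact_Icc (a := -M) (b := M)).prod
    (isCompact_Icc (a := -M) (b := M))).exists_bound_of_continuousOn h.continuous.continuousOn
  exact ⟨max K 0, le_max_right _ _, fun a b ha hb =>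
    (hK (a, b) ⟨abs_le.1 ha, abs_le.1 hb⟩).trans (le_max_left _ _)⟩

theorem isLipKernel_abs_sub (M : ℝ) : IsLipKernel M fun a b => |a - b| where
  continuous := by unfold Function.uncurry; fun_prop
  lipschitz := ⟨1, zero_le_one, fun a b b' _ _ _ => by
    refine (abs_abs_sub_abs_le_abs_sub _ _).trans (le_of_eq ?_)
    rw [one_mul, abs_sub_comm b b']; congr 1; ring⟩

theorem isLipKernel_signInt {k : ℝ → ℝ} (hk : Continuous k) (M : ℝ) :
    IsLipKernel M (signInt k) where
  continuous := continuous_signInt hk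
  lipschitz := by
    obtain ⟨K, hK0, hK⟩ := exists_bound_of_continuous hk M
    have hP : ∀ x y, |x| ≤ M → |y| ≤ M → |primitive k x - primitive k y| ≤ K * |x - y| := by
      intro x y hx hy
      have : primitive k x - primitive k y = ∫ s in y..x, k s :=
        intervalIntegral.integral_interval_sub_left (hk.intervalIntegrable _ _)
          (hk.intervalIntegrable _ _)
      rw [this]
      have h : ∀ s ∈ uIoc y x, ‖k s‖ ≤ K := fun s hs =>
        hK s (abs_le.2 (uIoc_subset_Icc_of_abs_le hx hy hs))
      exact intervalIntegral.norm_integral_le_of_norm_le_const h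
    refine ⟨2 * K, by positivity, fun a b b' ha hb hb' => ?_⟩
    rw [signInt_eq hk, signInt_eq hk]
    have e1 := hP (max a b) (max a b') (abs_max_le_max_abs_abs.trans (max_le ha hb))
      (abs_max_le_max_abs_abs.trans (max_le ha hb'))
    have e2 := hP (min a b) (min a b') (abs_min_le_max_abs_abs.trans (max_le ha hb))
      (abs_min_le_max_abs_abs.trans (max_le ha hb'))
    have e3 : |max a b - max a b'| ≤ |b - b'| := by
      simpa using abs_max_sub_max_le_max a b a b'
    have e4 : |min a b - min a b'| ≤ |b - b'| := by
      simpa using abs_min_sub_min_le_max a b a b'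
    have e5 := mul_le_mul_of_nonneg_left e3 hK0
    have e6 := mul_le_mul_of_nonneg_left e4 hK0
    have e7 := abs_sub (primitive k (max a b) - primitive k (max a b'))
      (primitive k (min a b) - primitive k (min a b'))
    calc _ = |primitive k (max a b) - primitive k (max a b') -
          (primitive k (min a b) - primitive k (min a b'))| := by congr 1; ring
      _ ≤ _ := by linarith

/-! ### The diagonal test functions -/

/-- The difference p.1 - p.2 is constant along (e, e), so κ is not differentiated. The result has
the same product shape, hence the lemma also yields second derivatives. -/
theorem fderiv_diagonal {V : Type*} [NormedAddCommGroup V] [NormedSpace ℝ V] {α κ : V → ℝ}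
    (hα : ContDiff ℝ ∞ α) (hκ : ContDiff ℝ ∞ κ) (p : V × V) (e : V) :
    fderiv ℝ (fun p : V × V => α p.1 * κ (p.1 - p.2)) p (e, e) =
      fderiv ℝ α p.1 e * κ (p.1 - p.2) := by
  have h1 : HasFDerivAt (fun p : V × V => α p.1)
      ((fderiv ℝ α p.1).comp (ContinuousLinearMap.fst ℝ V V)) p :=
    ((hα.differentiable (by simp) p.1).hasFDerivAt).comp p hasFDerivAt_fst
  have h2 : HasFDerivAt (fun p : V × V => κ (p.1 - p.2))
      ((fderiv ℝ κ (p.1 - p.2)).comp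
        (ContinuousLinearMap.fst ℝ V V - ContinuousLinearMap.snd ℝ V V)) p :=
    ((hκ.differentiable (by simp) (p.1 - p.2)).hasFDerivAt).comp p
      (f := fun p : V × V => p.1 - p.2) (hasFDerivAt_fst.sub hasFDerivAt_snd)
  rw [show fderiv ℝ (fun p : V × V => α p.1 * κ (p.1 - p.2)) p = _ from (h1.mul h2).fderiv]
  simp [mul_comm]

/-- On the support the second variable stays within r of the support of α; the thickening hypothesis
keeps it at positive times. -/
theorem isDoubleTest_diagonal {α κ : SpaceTime d → ℝ} (hα : IsTestFunction α)
    (hκ : ContDiff ℝ ∞ κ) {r : ℝ} (hr : tsupport κ ⊆ Metric.closedBall 0 r)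
    (hsub : Metric.cthickening r (tsupport α) ⊆ halfSpace d) :
    IsDoubleTest fun p => α p.1 * κ (p.1 - p.2) := by
  have hsupp : tsupport (fun p : SpaceTime d × SpaceTime d => α p.1 * κ (p.1 - p.2)) ⊆
      tsupport α ×ˢ Metric.cthickening r (tsupport α) := by
    have h1 : tsupport (fun p : SpaceTime d × SpaceTime d => α p.1 * κ (p.1 - p.2)) ⊆
        {p | p.1 ∈ tsupport α ∧ p.1 - p.2 ∈ tsupport κ} := by
      refine closure_minimal (fun p hp => ?_) ?_
      · exact ⟨subset_tsupport _ (left_ne_zero_of_mul hp),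
          subset_tsupport _ (right_ne_zero_of_mul hp)⟩
      · exact ((isClosed_tsupport α).preimage continuous_fst).inter
          ((isClosed_tsupport κ).preimage (continuous_fst.sub continuous_snd))
    intro p hp
    obtain ⟨h2, h3⟩ := h1 hp
    refine ⟨h2, Metric.mem_cthickening_of_dist_le p.2 p.1 r _ h2 ?_⟩
    have := hr h3
    rwa [mem_closedBall_zero_iff, ← dist_eq_norm, dist_comm] at this
  refine ⟨?_, ?_, ?_⟩
  · have := hα.smooth
    fun_prop
  · exact (hα.compact.isCompact.prod hα.compact.isCompact.cthickening).of_isClosed_subset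
      (isClosed_tsupport _) hsupp
  · exact hsupp.trans (prod_mono hα.supp hsub)

/-- A sequence of smooth bumps on space-time shrinking to the origin. -/
noncomputable def spaceTimeBump (d n : ℕ) : ContDiffBump (0 : SpaceTime d) where
  rIn := 1 / (n + 1 : ℝ) / 2
  rOut := 1 / (n + 1 : ℝ)
  rIn_pos := by positivity
  rIn_lt_rOut := half_lt_self (by positivity)

/-- The mollifiers on space-time. -/
noncomputable def mollifier (d n : ℕ) : SpaceTime d → ℝ := (spaceTimeBump d n).normed volume

theorem contDiff_mollifier (n : ℕ) : ContDiff ℝ ∞ (mollifier d n) :=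
  (spaceTimeBump d n).contDiff_normed

theorem mollifier_nonneg (n : ℕ) (z : SpaceTime d) : 0 ≤ mollifier d n z :=
  (spaceTimeBump d n).nonneg_normed z

theorem tsupport_mollifier (n : ℕ) :
    tsupport (mollifier d n) = Metric.closedBall 0 (1 / (n + 1 : ℝ)) :=
  (spaceTimeBump d n).tsupport_normed_eq

theorem integral_mollifier_sub (n : ℕ) (z : SpaceTime d) :
    ∫ w, mollifier d n (z - w) = 1 := by
  rw [integral_sub_left_eq_self (mollifier d n) volume z]
  exact (spaceTimeBump d n).integral_normed

theorem integrable_mollifier_sub (n : ℕ) (z : SpaceTime d) :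
    Integrable fun w => mollifier d n (z - w) :=
  (spaceTimeBump d n).integrable_normed.comp_sub_left z

theorem eventually_cthickening_subset {K U : Set (SpaceTime d)} (hK : IsCompact K)
    (hU : IsOpen U) (hKU : K ⊆ U) :
    ∀ᶠ n : ℕ in atTop, Metric.cthickening (1 / (n + 1 : ℝ)) K ⊆ U := by
  obtain ⟨δ, hδ, h⟩ := hK.exists_cthickening_subset_open hU hKU
  filter_upwards [(tendsto_one_div_add_atTop_nhds_zero_nat (𝕜 := ℝ)).eventually_lt_const hδ]
    with n hn
  exact (Metric.cthickening_mono hn.le K).trans h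

/-- A Lebesgue point of v is one of G(a, v(·)) for every Lipschitz kernel G and every a. The null
set is therefore independent of a and G, which allows the later choice a = u(z). -/
theorem ae_tendsto_integral_mollifier {v : SpaceTime d → ℝ} {M : ℝ} (hv : Measurable v)
    (hvM : ∀ z, |v z| ≤ M) : ∀ᵐ z ∂(volume : Measure (SpaceTime d)), z ∈ halfSpace d →
    ∀ a, |a| ≤ M → ∀ G, IsLipKernel M G →
      Tendsto (fun n => ∫ w in halfSpace d, G a (v w) * mollifier d n (z - w)) atTop
        (𝓝 (G a (v z))) := by
  have hloc : ∀ {F : SpaceTime d → ℝ} {C : ℝ}, Measurable F → (∀ z, |F z| ≤ C) →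
      LocallyIntegrable F := fun hF hC => by
    refine (memLp_top_of_bound hF.aestronglyMeasurable _ (Eventually.of_forall hC)).locallyIntegrable
      (by simp)
  filter_upwards [(Besicovitch.vitaliFamily volume).ae_tendsto_average_norm_sub (hloc hv hvM)]
    with z h₀ hz a ha G hG
  have hr : Tendsto (fun n : ℕ => 1 / (n + 1 : ℝ)) atTop (𝓝[>] 0) :=
    tendsto_nhdsWithin_iff.2 ⟨tendsto_one_div_add_atTop_nhds_zero_nat,
      Eventually.of_forall fun n => by simp only [mem_Ioi]; positivity⟩
  have h1 := (h₀.comp (Besicovitch.tendsto_filterAt volume z)).comp hr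
  obtain ⟨L, hL0, hL⟩ := hG.lipschitz
  obtain ⟨C, hC0, hC⟩ := hG.bound
  have hGm : Measurable fun w => G a (v w) :=
    hG.continuous.measurable.comp (measurable_const.prodMk hv)
  have hGloc : LocallyIntegrable fun w => G a (v w) := hloc hGm fun w => hC a _ ha (hvM w)
  have h2 : Tendsto (fun n : ℕ => ⨍ w in Metric.closedBall z (1 / (n + 1 : ℝ)),
      ‖G a (v w) - G a (v z)‖) atTop (𝓝 0) := by
    have h3 := h1.const_mul L
    rw [mul_zero] at h3
    refine squeeze_zero (fun n => ?_) (fun n => ?_) h3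
    · rw [setAverage_eq]
      exact smul_nonneg (by positivity) (integral_nonneg fun _ => norm_nonneg _)
    · simp only [Function.comp]
      rw [setAverage_eq, setAverage_eq, smul_eq_mul, smul_eq_mul, mul_left_comm,
        ← integral_const_mul L]
      refine mul_le_mul_of_nonneg_left ?_ (inv_nonneg.2 measureReal_nonneg)
      have i1 := ((hGloc.integrableOn_isCompact (isCompact_closedBall z (1 / (n + 1 : ℝ)))).sub
        (integrableOn_const (C := G a (v z)) (measure_closedBall_lt_top).ne)).norm
      have i2 := (((hloc hv hvM).integrableOn_isCompact
        (isCompact_closedBall z (1 / (n + 1 : ℝ)))).sub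
        (integrableOn_const (C := v z) (measure_closedBall_lt_top).ne)).norm.const_mul L
      exact integral_mono i1 i2 fun w => hL a _ _ ha (hvM _) (hvM _)
  -- The inner radius of the bump is half the outer one, so the mollifier is at most 2^dim divided
  -- by the volume of its supporting ball.
  have h4 := tendsto_integral_smul_of_tendsto_average_norm_sub
    (g := fun n w => mollifier d n (z - w)) (2 ^ (Module.finrank ℝ (SpaceTime d))) h2
    (Eventually.of_forall fun n => hGloc.integrableOn_isCompact (isCompact_closedBall _ _))
    (by simp only [integral_mollifier_sub]; exact tendsto_const_nhds)
    (Eventually.of_forall fun n w hw => by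
      have := subset_tsupport _ (Function.mem_support.2 hw)
      rw [tsupport_mollifier, mem_closedBall_zero_iff, ← dist_eq_norm, dist_comm] at this
      exact this)
    (Eventually.of_forall fun n w => by
      rw [abs_of_nonneg (mollifier_nonneg _ _), Measure.addHaar_real_closedBall_center]
      refine (spaceTimeBump d n).normed_le_div_measure_closedBall_rOut _ _ ?_ _
      simp only [spaceTimeBump]
      linarith)
  -- For large n the support of the mollifier around z lies in the open half space, so restricting
  -- the integral changes nothing.
  refine h4.congr' ?_
  filter_upwards [eventually_cthickening_subset isCompact_singleton isOpen_halfSpace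
    (singleton_subset_iff.2 hz)] with n hn
  rw [setIntegral_eq_integral_of_forall_compl_eq_zero]
  · simp only [smul_eq_mul, mul_comm]
  · intro w hw
    have : z - w ∉ tsupport (mollifier d n) := fun h => hw (hn (by
      rw [tsupport_mollifier, mem_closedBall_zero_iff, ← dist_eq_norm, dist_comm] at h
      exact Metric.mem_cthickening_of_dist_le w z _ _ rfl h))
    rw [image_eq_zero_of_notMem_tsupport this, mul_zero]

theorem eventually_isDoubleTest {α : SpaceTime d → ℝ} (hα : IsTestFunction α) :
    ∀ᶠ n : ℕ in atTop, IsDoubleTest fun p => α p.1 * mollifier d n (p.1 - p.2) := by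
  filter_upwards [eventually_cthickening_subset hα.compact.isCompact isOpen_halfSpace hα.supp]
    with n hn
  exact isDoubleTest_diagonal hα (contDiff_mollifier n) (tsupport_mollifier n).subset hn

/-! ### Letting the two variables coalesce: Kato's inequality -/

namespace IsRegularSolution

variable {f : Fin d → ℝ → ℝ} {A σ : Fin d → Fin d → ℝ → ℝ} {M : ℝ}
  {u v : SpaceTime d → ℝ} {g h : Fin d → SpaceTime d → ℝ}

/-- The mollifiers have mass one, so the inner integral over w is dominated by C |α(z)| uniformly in
n, and it converges at almost every z. -/
theorem tendsto_integral_diagonal (hu : IsRegularSolution f A σ M u g)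
    (hv : IsRegularSolution f A σ M v h) {G : ℝ → ℝ → ℝ} (hG : IsLipKernel M G)
    {α : SpaceTime d → ℝ} (hα : IsTestFunction α) :
    Tendsto (fun n => ∫ p, G (u p.1) (v p.2) * (α p.1 * mollifier d n (p.1 - p.2))
      ∂((halfVol d).prod (halfVol d))) atTop
      (𝓝 (∫ z in halfSpace d, G (u z) (v z) * α z)) := by
  obtain ⟨C, hC0, hC⟩ := hG.bound
  have hint : ∀ᶠ n : ℕ in atTop, Integrable (fun p : SpaceTime d × SpaceTime d =>
      G (u p.1) (v p.2) * (α p.1 * mollifier d n (p.1 - p.2)))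
      ((halfVol d).prod (halfVol d)) := by
    filter_upwards [eventually_isDoubleTest hα] with n hn
    exact hu.integrable_term hv hG.continuous hn
  have hlim : Tendsto (fun n => ∫ z in halfSpace d, ∫ w in halfSpace d,
      G (u z) (v w) * (α z * mollifier d n (z - w))) atTop
      (𝓝 (∫ z in halfSpace d, G (u z) (v z) * α z)) := by
    refine tendsto_integral_filter_of_dominated_convergence (fun z => C * |α z|) ?_ ?_ ?_ ?_
    · filter_upwards [hint] with n hn using hn.integral_prod_left.aestronglyMeasurable
    · refine Eventually.of_forall fun n => Eventually.of_forall fun z => ?_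
      have hi : Integrable (fun w => C * |α z| * mollifier d n (z - w)) :=
        (integrable_mollifier_sub n z).const_mul _
      calc ‖∫ w in halfSpace d, G (u z) (v w) * (α z * mollifier d n (z - w))‖
          ≤ ∫ w in halfSpace d, C * |α z| * mollifier d n (z - w) := by
            refine norm_integral_le_of_norm_le hi.restrict (Eventually.of_forall fun w => ?_)
            rw [norm_mul, norm_mul, Real.norm_eq_abs, Real.norm_eq_abs, Real.norm_eq_abs,
              abs_of_nonneg (mollifier_nonneg n _), mul_assoc]
            exact mul_le_mul_of_nonneg_right (hC _ _ (hu.abs_le _) (hv.abs_le _))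
              (mul_nonneg (abs_nonneg _) (mollifier_nonneg _ _))
        _ ≤ ∫ w, C * |α z| * mollifier d n (z - w) :=
            setIntegral_le_integral hi (Eventually.of_forall fun w =>
              mul_nonneg (by positivity) (mollifier_nonneg _ _))
        _ = C * |α z| := by rw [integral_const_mul, integral_mollifier_sub, mul_one]
    · exact ((hα.smooth.continuous.integrable_of_hasCompactSupport
        hα.compact).abs.const_mul C).restrict
    · filter_upwards [ae_restrict_of_ae (ae_tendsto_integral_mollifier hv.measurable hv.abs_le),
        ae_restrict_mem measurableSet_halfSpace] with z h1 hz
      have h2 := (h1 hz (u z) (hu.abs_le z) G hG).const_mul (α z)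
      rw [mul_comm (α z)] at h2
      refine h2.congr fun n => ?_
      rw [← integral_const_mul]
      congr 1
      funext w
      ring
  refine hlim.congr' ?_
  filter_upwards [hint] with n hn
  rw [integral_prod _ hn]

/-- Kruzhkov's (Kato's) inequality for two entropy solutions. -/
theorem kruzhkov (hu : IsRegularSolution f A σ M u g) (hv : IsRegularSolution f A σ M v h)
    (hdata : IsData f A σ) {ψ : SpaceTime d → ℝ} (hψ : IsTestFunction ψ) (hψ0 : ∀ z, 0 ≤ ψ z) :
    0 ≤ (∫ z in halfSpace d, |u z - v z| * fderiv ℝ ψ z (tvec d))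
      + (∑ i, ∫ z in halfSpace d, signInt (deriv (f i)) (u z) (v z) * fderiv ℝ ψ z (xvec i))
      + ∑ i, ∑ j, ∫ z in halfSpace d, signInt (deriv (A i j)) (u z) (v z) *
          fderiv ℝ (fun z => fderiv ℝ ψ z (xvec j)) z (xvec i) := by
  have hf : ∀ i, Continuous (deriv (f i)) := fun i => (hdata.smooth_f i).continuous_deriv (by simp)
  have hA : ∀ i j, Continuous (deriv (A i j)) :=
    fun i j => (hdata.smooth_A i j).continuous_deriv (by simp)
  have lim := ((hu.tendsto_integral_diagonal hv (isLipKernel_abs_sub M)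
    (hψ.fderiv_apply (tvec d))).add (tendsto_finsetSum Finset.univ fun i _ =>
      hu.tendsto_integral_diagonal hv (isLipKernel_signInt (hf i) M)
        (hψ.fderiv_apply (xvec i)))).add
    (tendsto_finsetSum Finset.univ fun i _ => tendsto_finsetSum Finset.univ fun j _ =>
      hu.tendsto_integral_diagonal hv (isLipKernel_signInt (hA i j) M)
        ((hψ.fderiv_apply (xvec j)).fderiv_apply (xvec i)))
  refine ge_of_tendsto lim ?_
  filter_upwards [eventually_isDoubleTest hψ, eventually_isDoubleTest (hψ.fderiv_apply (tvec d)),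
    eventually_all.2 fun i : Fin d => eventually_isDoubleTest (hψ.fderiv_apply (xvec i)),
    eventually_all.2 fun i : Fin d => eventually_all.2 fun j : Fin d =>
      eventually_isDoubleTest ((hψ.fderiv_apply (xvec j)).fderiv_apply (xvec i))]
    with n h0 ht hx hxx
  have key := hu.doubled_kruzhkov hv hdata h0
    fun p => mul_nonneg (hψ0 _) (mollifier_nonneg _ _)
  -- All derivatives in the doubled inequality act along the diagonal and fall on ψ alone.
  have d1 : ∀ e : SpaceTime d, (fun p : SpaceTime d × SpaceTime d =>
      fderiv ℝ (fun p : SpaceTime d × SpaceTime d => ψ p.1 * mollifier d n (p.1 - p.2)) p (e, e)) =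
      fun p => fderiv ℝ ψ p.1 e * mollifier d n (p.1 - p.2) := fun e => by
    funext p
    exact fderiv_diagonal hψ.smooth (contDiff_mollifier n) p e
  have d2 : ∀ (e e' : SpaceTime d) (p : SpaceTime d × SpaceTime d), fderiv ℝ
      (fun p : SpaceTime d × SpaceTime d => fderiv ℝ ψ p.1 e * mollifier d n (p.1 - p.2)) p
        (e', e') =
      fderiv ℝ (fun z => fderiv ℝ ψ z e) p.1 e' * mollifier d n (p.1 - p.2) := fun e e' p =>
    fderiv_diagonal (hψ.fderiv_apply e).smooth (contDiff_mollifier n) p e'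
  have i1 := hu.integrable_term hv (isLipKernel_abs_sub M).continuous ht
  have i2 := fun i => hu.integrable_term hv (continuous_signInt (hf i)) (hx i)
  have i3 := fun i j => hu.integrable_term hv (continuous_signInt (hA i j)) (hxx i j)
  have i2s := integrable_finsetSum Finset.univ fun i _ => i2 i
  have i3s := fun i => integrable_finsetSum Finset.univ fun j _ => i3 i j
  have i3ss := integrable_finsetSum Finset.univ fun i _ => i3s i
  simp only [fun e => congrFun (d1 e), d2] at key
  refine key.trans_eq ?_
  refine (integral_add (i1.add i2s) i3ss).trans ?_
  refine congrArg₂ _ ((integral_add i1 i2s).trans ?_) ?_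
  · rw [integral_finsetSum _ fun i _ => i2 i]
  · rw [integral_finsetSum _ fun i _ => i3s i]
    exact Finset.sum_congr rfl fun i _ => integral_finsetSum _ fun j _ => i3 i j

end IsRegularSolution

end DegenerateParabolic

namespace DegenerateParabolic

variable {d : ℕ}

/-! ### Functions of time with a weak derivative bounded from above -/

/-- A sequence of smooth bumps on the line shrinking to the origin. -/
noncomputable def timeBump (n : ℕ) : ContDiffBump (0 : ℝ) where
  rIn := 1 / (n + 1 : ℝ) / 2
  rOut := 1 / (n + 1 : ℝ)
  rIn_pos := by positivity
  rIn_lt_rOut := half_lt_self (by positivity)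

/-- The hypothesis says J' ≤ C weakly on (0, ∞). Mollification makes this pointwise away from 0, so
J_n(t) - Ct is nonincreasing there. The set S consists of the times where J_n(t) → J(t), and the
inequality passes to the limit at two such times. -/
theorem exists_ae_le_of_weak_deriv_le {J : ℝ → ℝ} (hJ : LocallyIntegrable J) {C : ℝ}
    (h : ∀ θ : ℝ → ℝ, ContDiff ℝ ∞ θ → HasCompactSupport θ → tsupport θ ⊆ Ioi 0 →
      (∀ t, 0 ≤ θ t) →
      0 ≤ (∫ t in Ioi 0, deriv θ t * J t) + C * ∫ t in Ioi 0, θ t) :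
    ∃ S : Set ℝ, (∀ᵐ t, t ∈ S) ∧
      ∀ t₀ ∈ S, ∀ t₁ ∈ S, 0 < t₀ → t₀ < t₁ → J t₁ ≤ J t₀ + C * (t₁ - t₀) := by
  set ρ : ℕ → ℝ → ℝ := fun n => (timeBump n).normed volume
  set Jn : ℕ → ℝ → ℝ := fun n => convolution (ρ n) J (ContinuousLinearMap.lsmul ℝ ℝ) volume
  have hρ : ∀ n, ContDiff ℝ ∞ (ρ n) := fun n => (timeBump n).contDiff_normed
  have hρc : ∀ n, HasCompactSupport (ρ n) := fun n => (timeBump n).hasCompactSupport_normed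
  have hder : ∀ n t, HasDerivAt (Jn n)
      ((convolution (deriv (ρ n)) J (ContinuousLinearMap.lsmul ℝ ℝ) volume) t) t := fun n t =>
    (hρc n).hasDerivAt_convolution_left _ ((hρ n).of_le (by simp)) hJ t
  have hbound : ∀ (n : ℕ) t, 1 / (n + 1 : ℝ) < t →
      (convolution (deriv (ρ n)) J (ContinuousLinearMap.lsmul ℝ ℝ) volume) t ≤ C := by
    intro n t ht
    have hsupp : ∀ s, ρ n (t - s) ≠ 0 → s ∈ Metric.closedBall t (1 / (n + 1 : ℝ)) := by
      intro s hs
      have := subset_tsupport _ (Function.mem_support.2 hs)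
      rw [show tsupport (ρ n) = Metric.closedBall 0 (1 / (n + 1 : ℝ)) from
        (timeBump n).tsupport_normed_eq, mem_closedBall_zero_iff, ← dist_eq_norm, dist_comm] at this
      exact this
    have hball : Metric.closedBall t (1 / (n + 1 : ℝ)) ⊆ Ioi 0 := by
      intro s hs
      rw [Real.closedBall_eq_Icc] at hs
      have := hs.1
      simp only [mem_Ioi]
      linarith
    have hts : tsupport (fun s => ρ n (t - s)) ⊆ Metric.closedBall t (1 / (n + 1 : ℝ)) :=
      closure_minimal (fun s hs => hsupp s hs) Metric.isClosed_closedBall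
    have hsm : ContDiff ℝ ∞ fun s => ρ n (t - s) := by
      have := hρ n
      fun_prop
    -- The reflected mollifier is the test function. Its s-derivative is -ρ_n'(t - s), which turns
    -- the weak inequality into a bound on J_n'(t); the condition t > 1/(n+1) keeps its support in
    -- (0, ∞).
    have key := h (fun s => ρ n (t - s)) hsm
      ((isCompact_closedBall _ _).of_isClosed_subset (isClosed_tsupport _) hts)
      (hts.trans hball) (fun s => (timeBump n).nonneg_normed _)
    have e1 : ∫ s in Ioi 0, ρ n (t - s) = 1 := by
      rw [setIntegral_eq_integral_of_forall_compl_eq_zero,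
        integral_sub_left_eq_self (ρ n) volume t]
      · exact (timeBump n).integral_normed
      · intro s hs
        by_contra hne
        exact hs (hball (hsupp s hne))
    have e2 : ∀ s, deriv (fun s => ρ n (t - s)) s = -deriv (ρ n) (t - s) := fun s =>
      deriv_comp_const_sub (f := ρ n) t s
    have e3 : ∫ s in Ioi 0, deriv (fun s => ρ n (t - s)) s * J s =
        -(convolution (deriv (ρ n)) J (ContinuousLinearMap.lsmul ℝ ℝ) volume) t := by
      rw [setIntegral_eq_integral_of_forall_compl_eq_zero, convolution_eq_swap, ← integral_neg]
      · congr 1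
        funext s
        rw [e2]
        simp
      · intro s hs
        have : s ∉ tsupport (deriv fun s => ρ n (t - s)) := fun h' =>
          hs (hball (hts (tsupport_deriv_subset h')))
        rw [image_eq_zero_of_notMem_tsupport this, zero_mul]
    rw [e1, e3] at key
    linarith
  refine ⟨{t | Tendsto (fun n => Jn n t) atTop (𝓝 (J t))}, ?_, ?_⟩
  · exact ContDiffBump.ae_convolution_tendsto_right_of_locallyIntegrable
      (φ := timeBump) (K := 2) tendsto_one_div_add_atTop_nhds_zero_nat
      (Eventually.of_forall fun n => by simp only [timeBump]; linarith) hJ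
  · intro t₀ h₀ t₁ h₁ hpos hlt
    refine le_of_tendsto_of_tendsto h₁ (h₀.add_const (C * (t₁ - t₀))) ?_
    filter_upwards [(tendsto_one_div_add_atTop_nhds_zero_nat (𝕜 := ℝ)).eventually_lt_const hpos]
      with n hn
    have hanti : AntitoneOn (fun t => Jn n t - C * t) (Ioi (1 / (n + 1 : ℝ))) := by
      have hd : ∀ t, HasDerivAt (fun t => Jn n t - C * t)
          ((convolution (deriv (ρ n)) J (ContinuousLinearMap.lsmul ℝ ℝ) volume) t - C) t :=
        fun t => (hder n t).sub (by simpa using (hasDerivAt_id t).const_mul C)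
      refine antitoneOn_of_deriv_nonpos (convex_Ioi _)
        (fun t _ => (hd t).continuousAt.continuousWithinAt)
        (fun t _ => (hd t).differentiableAt.differentiableWithinAt) fun t ht => ?_
      rw [interior_Ioi] at ht
      rw [(hd t).deriv]
      linarith [hbound n t ht]
    have := hanti hn (hn.trans hlt) hlt.le
    simp only at this
    linarith

/-! ### Test functions with separated variables -/

theorem fderiv_separated {θ : ℝ → ℝ} {χ : (Fin d → ℝ) → ℝ} (hθ : ContDiff ℝ ∞ θ)
    (hχ : ContDiff ℝ ∞ χ) (z : SpaceTime d) (a : ℝ) (e : Fin d → ℝ) :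
    fderiv ℝ (fun z : SpaceTime d => θ z.1 * χ z.2) z (a, e) =
      a * deriv θ z.1 * χ z.2 + θ z.1 * fderiv ℝ χ z.2 e := by
  have h1 : HasFDerivAt (fun z : SpaceTime d => θ z.1)
      ((fderiv ℝ θ z.1).comp (ContinuousLinearMap.fst ℝ ℝ (Fin d → ℝ))) z :=
    ((hθ.differentiable (by simp) z.1).hasFDerivAt).comp z hasFDerivAt_fst
  have h2 : HasFDerivAt (fun z : SpaceTime d => χ z.2)
      ((fderiv ℝ χ z.2).comp (ContinuousLinearMap.snd ℝ ℝ (Fin d → ℝ))) z :=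
    ((hχ.differentiable (by simp) z.2).hasFDerivAt).comp z hasFDerivAt_snd
  rw [show fderiv ℝ (fun z : SpaceTime d => θ z.1 * χ z.2) z = _ from (h1.mul h2).fderiv]
  have h3 : fderiv ℝ θ z.1 a = a * deriv θ z.1 := by
    rw [← fderiv_apply_one_eq_deriv, ← smul_eq_mul, ← map_smul]; simp
  simp [h3]
  ring

theorem isTestFunction_separated {θ : ℝ → ℝ} {χ : (Fin d → ℝ) → ℝ} (hθ : ContDiff ℝ ∞ θ)
    (hθc : HasCompactSupport θ) (hθs : tsupport θ ⊆ Ioi 0) (hχ : ContDiff ℝ ∞ χ)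
    (hχc : HasCompactSupport χ) : IsTestFunction fun z : SpaceTime d => θ z.1 * χ z.2 := by
  have hsupp : tsupport (fun z : SpaceTime d => θ z.1 * χ z.2) ⊆ tsupport θ ×ˢ tsupport χ :=
    closure_minimal (fun z hz => ⟨subset_tsupport _ (left_ne_zero_of_mul hz),
      subset_tsupport _ (right_ne_zero_of_mul hz)⟩)
      ((isClosed_tsupport _).prod (isClosed_tsupport _))
  exact ⟨by fun_prop, (hθc.isCompact.prod hχc.isCompact).of_isClosed_subset
    (isClosed_tsupport _) hsupp, fun z hz => ⟨hθs (hsupp hz).1, trivial⟩⟩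

theorem halfVol_eq_prod :
    halfVol d = ((volume : Measure ℝ).restrict (Ioi 0)).prod (volume : Measure (Fin d → ℝ)) := by
  rw [halfVol, halfSpace, Measure.volume_eq_prod, ← Measure.prod_restrict, Measure.restrict_univ]

/-- The `L¹`-size of the first and second derivatives of a spatial cutoff, with weights. -/
noncomputable def cutoffCost (K₁ : Fin d → ℝ) (K₂ : Fin d → Fin d → ℝ) (χ : (Fin d → ℝ) → ℝ) :
    ℝ :=
  (∑ i, K₁ i * ∫ x, |fderiv ℝ χ x (Pi.single i 1)|)
    + ∑ i, ∑ j, K₂ i j *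
      ∫ x, |fderiv ℝ (fun x => fderiv ℝ χ x (Pi.single j 1)) x (Pi.single i 1)|

theorem abs_integral_separated_le {G : ℝ → ℝ → ℝ} {K M : ℝ}
    (hK : ∀ a b, |a| ≤ M → |b| ≤ M → |G a b| ≤ K) {u v : SpaceTime d → ℝ}
    (huM : ∀ z, |u z| ≤ M) (hvM : ∀ z, |v z| ≤ M) {θ : ℝ → ℝ} (hθ : Continuous θ)
    (hθc : HasCompactSupport θ) (hθ0 : ∀ t, 0 ≤ θ t) {ξ : (Fin d → ℝ) → ℝ} (hξ : Continuous ξ)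
    (hξc : HasCompactSupport ξ) :
    ∫ z in halfSpace d, G (u z) (v z) * (θ z.1 * ξ z.2) ≤
      K * (∫ x, |ξ x|) * ∫ t in Ioi 0, θ t := by
  have hi : Integrable (fun z : SpaceTime d => K * (θ z.1 * |ξ z.2|)) (halfVol d) := by
    rw [halfVol_eq_prod]
    exact ((hθ.integrable_of_hasCompactSupport hθc).restrict.mul_prod
      (hξ.integrable_of_hasCompactSupport hξc).abs).const_mul K
  refine (Real.le_norm_self _).trans ((norm_integral_le_of_norm_le hi
    (Eventually.of_forall fun z => ?_)).trans (le_of_eq ?_))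
  · rw [norm_mul, norm_mul, Real.norm_eq_abs, Real.norm_eq_abs, Real.norm_eq_abs,
      abs_of_nonneg (hθ0 _)]
    exact mul_le_mul_of_nonneg_right (hK _ _ (huM _) (hvM _))
      (mul_nonneg (hθ0 _) (abs_nonneg _))
  · rw [integral_const_mul]
    change K * ∫ z, θ z.1 * |ξ z.2| ∂(halfVol d) = _
    rw [halfVol_eq_prod, integral_prod_mul θ fun x => |ξ x|]
    ring

/-! ### Growth of the localized L¹ distance -/

namespace IsRegularSolution

variable {f : Fin d → ℝ → ℝ} {A σ : Fin d → Fin d → ℝ → ℝ} {M : ℝ}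
  {u v : SpaceTime d → ℝ} {g h : Fin d → SpaceTime d → ℝ}

/-- The constants bound the flux kernels on [-M, M]² and are chosen before the cutoff χ. This
uniformity is what makes rescaling χ profitable. -/
theorem exists_localized_kruzhkov (hu : IsRegularSolution f A σ M u g)
    (hv : IsRegularSolution f A σ M v h) (hdata : IsData f A σ) :
    ∃ (K₁ : Fin d → ℝ) (K₂ : Fin d → Fin d → ℝ), (∀ i, 0 ≤ K₁ i) ∧ (∀ i j, 0 ≤ K₂ i j) ∧
      ∀ χ : (Fin d → ℝ) → ℝ, ContDiff ℝ ∞ χ → HasCompactSupport χ → (∀ x, 0 ≤ χ x) →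
      ∀ θ : ℝ → ℝ, ContDiff ℝ ∞ θ → HasCompactSupport θ → tsupport θ ⊆ Ioi 0 →
      (∀ t, 0 ≤ θ t) →
      0 ≤ (∫ t in Ioi 0, deriv θ t * ∫ x, |u (t, x) - v (t, x)| * χ x)
        + cutoffCost K₁ K₂ χ * ∫ t in Ioi 0, θ t := by
  have hf : ∀ i, Continuous (deriv (f i)) := fun i => (hdata.smooth_f i).continuous_deriv (by simp)
  have hA : ∀ i j, Continuous (deriv (A i j)) :=
    fun i j => (hdata.smooth_A i j).continuous_deriv (by simp)
  choose K₁ hK₁0 hK₁ using fun i => (isLipKernel_signInt (hf i) M).bound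
  choose K₂ hK₂0 hK₂ using fun i j => (isLipKernel_signInt (hA i j) M).bound
  refine ⟨K₁, K₂, hK₁0, hK₂0, fun χ hχ hχc hχ0 θ hθ hθc hθs hθ0 => ?_⟩
  have key := hu.kruzhkov hv hdata (isTestFunction_separated hθ hθc hθs hχ hχc)
    fun z => mul_nonneg (hθ0 _) (hχ0 _)
  have hχ1 : ∀ e, ContDiff ℝ ∞ fun x => fderiv ℝ χ x e := contDiff_fderiv_apply hχ
  have hχ1c : ∀ e, HasCompactSupport fun x => fderiv ℝ χ x e := hχc.fderiv_apply ℝ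
  have hχ2 : ∀ e e', ContDiff ℝ ∞ fun x => fderiv ℝ (fun x => fderiv ℝ χ x e) x e' :=
    fun e => contDiff_fderiv_apply (hχ1 e)
  have hχ2c : ∀ e e', HasCompactSupport fun x => fderiv ℝ (fun x => fderiv ℝ χ x e) x e' :=
    fun e => (hχ1c e).fderiv_apply ℝ
  have dx1 : ∀ i, (fun z : SpaceTime d => fderiv ℝ (fun z : SpaceTime d => θ z.1 * χ z.2) z
      (xvec i)) = fun z => θ z.1 * fderiv ℝ χ z.2 (Pi.single i 1) := fun i => by
    funext z
    rw [xvec, fderiv_separated hθ hχ]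
    simp
  have dx2 : ∀ i j (z : SpaceTime d), fderiv ℝ (fun z : SpaceTime d =>
      θ z.1 * fderiv ℝ χ z.2 (Pi.single j 1)) z (xvec i) =
      θ z.1 * fderiv ℝ (fun x => fderiv ℝ χ x (Pi.single j 1)) z.2 (Pi.single i 1) := by
    intro i j z
    rw [xvec, fderiv_separated hθ (hχ1 _)]
    simp
  have dt1 : ∀ z : SpaceTime d, fderiv ℝ (fun z : SpaceTime d => θ z.1 * χ z.2) z (tvec d) =
      deriv θ z.1 * χ z.2 := fun z => by
    rw [tvec, fderiv_separated hθ hχ]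
    simp
  simp only [fun i => congrFun (dx1 i), dx2, dt1] at key
  have time : ∫ z in halfSpace d, |u z - v z| * (deriv θ z.1 * χ z.2) =
      ∫ t in Ioi 0, deriv θ t * ∫ x, |u (t, x) - v (t, x)| * χ x := by
    have hθ1 : Continuous (deriv θ) := hθ.continuous_deriv (by simp)
    have hi : Integrable (fun z : SpaceTime d => |u z - v z| * (deriv θ z.1 * χ z.2))
        (((volume : Measure ℝ).restrict (Ioi 0)).prod (volume : Measure (Fin d → ℝ))) := by
      refine Integrable.bdd_mul (c := M + M) ((hθ1.integrable_of_hasCompactSupport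
        hθc.deriv).restrict.mul_prod (hχ.continuous.integrable_of_hasCompactSupport hχc))
        (hu.measurable.sub hv.measurable).abs.aestronglyMeasurable
        (Eventually.of_forall fun z => ?_)
      rw [Real.norm_eq_abs, abs_abs]
      exact (abs_sub _ _).trans (add_le_add (hu.abs_le z) (hv.abs_le z))
    change ∫ z, |u z - v z| * (deriv θ z.1 * χ z.2) ∂(halfVol d) = _
    rw [halfVol_eq_prod, integral_prod _ hi]
    congr 1
    funext t
    rw [← integral_const_mul]
    congr 1
    funext x
    ring
  rw [time] at key
  refine key.trans ?_
  rw [add_assoc]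
  refine add_le_add le_rfl ?_
  rw [cutoffCost, add_mul, Finset.sum_mul, Finset.sum_mul]
  refine add_le_add (Finset.sum_le_sum fun i _ => ?_) (Finset.sum_le_sum fun i _ => ?_)
  · exact abs_integral_separated_le (hK₁ i) hu.abs_le hv.abs_le hθ.continuous hθc hθ0
      (hχ1 _).continuous (hχ1c _)
  · rw [Finset.sum_mul]
    exact Finset.sum_le_sum fun j _ => abs_integral_separated_le (hK₂ i j) hu.abs_le hv.abs_le
      hθ.continuous hθc hθ0 (hχ2 _ _).continuous (hχ2c _ _)

/-- Off a null set of times, the localized `L¹` distance grows at most linearly. -/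
theorem exists_localized_growth (hu : IsRegularSolution f A σ M u g)
    (hv : IsRegularSolution f A σ M v h) (hdata : IsData f A σ) :
    ∃ (K₁ : Fin d → ℝ) (K₂ : Fin d → Fin d → ℝ), (∀ i, 0 ≤ K₁ i) ∧ (∀ i j, 0 ≤ K₂ i j) ∧
      ∀ χ : (Fin d → ℝ) → ℝ, ContDiff ℝ ∞ χ → HasCompactSupport χ → (∀ x, 0 ≤ χ x) →
      ∃ S : Set ℝ, (∀ᵐ t, t ∈ S) ∧ ∀ t₀ ∈ S, ∀ t₁ ∈ S, 0 < t₀ → t₀ < t₁ →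
        ∫ x, |u (t₁, x) - v (t₁, x)| * χ x ≤
          (∫ x, |u (t₀, x) - v (t₀, x)| * χ x) + cutoffCost K₁ K₂ χ * (t₁ - t₀) := by
  obtain ⟨K₁, K₂, h1, h2, key⟩ := hu.exists_localized_kruzhkov hv hdata
  refine ⟨K₁, K₂, h1, h2, fun χ hχ hχc hχ0 => ?_⟩
  refine exists_ae_le_of_weak_deriv_le ?_ (key χ hχ hχc hχ0)
  have hmeas : Measurable fun z : SpaceTime d => |u z - v z| * χ z.2 :=
    (hu.measurable.sub hv.measurable).abs.mul (hχ.continuous.measurable.comp measurable_snd)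
  have hi : Integrable fun x => (M + M) * |χ x| :=
    (hχ.continuous.integrable_of_hasCompactSupport hχc).abs.const_mul _
  refine (memLp_top_of_bound (hmeas.stronglyMeasurable.integral_prod_right').aestronglyMeasurable
    (∫ x, (M + M) * |χ x|) (Eventually.of_forall fun t => ?_)).locallyIntegrable (by simp)
  refine norm_integral_le_of_norm_le hi (Eventually.of_forall fun x => ?_)
  rw [norm_mul, Real.norm_eq_abs, Real.norm_eq_abs, abs_abs]
  exact mul_le_mul_of_nonneg_right ((abs_sub _ _).trans (add_le_add (hu.abs_le _) (hv.abs_le _)))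
    (abs_nonneg _)

end IsRegularSolution

end DegenerateParabolic

namespace DegenerateParabolic

variable {d : ℕ}

/-! ### Spatial cutoffs -/

/-- A bump equal to one on the unit cube and supported in a slightly larger cube. -/
noncomputable def spaceBump (d m : ℕ) : ContDiffBump (0 : Fin d → ℝ) where
  rIn := 1 / 2
  rOut := (1 + 1 / (m + 1 : ℝ)) / 2
  rIn_pos := by norm_num
  rIn_lt_rOut := by
    have : 0 < 1 / (m + 1 : ℝ) := by positivity
    linarith

/-- The rescaled bump, equal to one on `cube d (n + 1)`. -/
noncomputable def cutoff (d m n : ℕ) (x : Fin d → ℝ) : ℝ :=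
  spaceBump d m ((n + 1 : ℝ)⁻¹ • x)

/-- The norm on `Fin d → ℝ` is the supremum norm, so the balls on which smooth bumps are prescribed
are the cubes of the seminorm. -/
theorem mem_cube_iff {R : ℝ} (hR : 0 ≤ R) {x : Fin d → ℝ} : x ∈ cube d R ↔ ‖x‖ ≤ R / 2 := by
  rw [pi_norm_le_iff_of_nonneg (by positivity)]
  rfl

theorem measurableSet_cube (R : ℝ) : MeasurableSet (cube d R) := by
  have : cube d R = ⋂ i, {x : Fin d → ℝ | |x i| ≤ R / 2} := by
    ext x; simp [cube]
  rw [this]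
  exact MeasurableSet.iInter fun i => measurableSet_le (by fun_prop) measurable_const

theorem contDiff_cutoff (m n : ℕ) : ContDiff ℝ ∞ (cutoff d m n) :=
  (spaceBump d m).contDiff.comp (contDiff_const_smul _)

theorem cutoff_nonneg (m n : ℕ) (x : Fin d → ℝ) : 0 ≤ cutoff d m n x := (spaceBump d m).nonneg

theorem cutoff_le_one (m n : ℕ) (x : Fin d → ℝ) : cutoff d m n x ≤ 1 := (spaceBump d m).le_one

theorem hasCompactSupport_cutoff (m n : ℕ) : HasCompactSupport (cutoff d m n) :=
  (spaceBump d m).hasCompactSupport.comp_smul (c := (n + 1 : ℝ)⁻¹) (by positivity)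

theorem cutoff_eq_one {m n : ℕ} {x : Fin d → ℝ} (hx : x ∈ cube d (n + 1)) :
    cutoff d m n x = 1 := by
  rw [mem_cube_iff (by positivity)] at hx
  refine (spaceBump d m).one_of_mem_closedBall ?_
  rw [mem_closedBall_zero_iff, norm_smul, norm_inv, Real.norm_of_nonneg (by positivity),
    inv_mul_le_iff₀ (by positivity)]
  simp only [spaceBump]
  linarith

theorem cutoff_eq_zero {m n : ℕ} {x : Fin d → ℝ}
    (hx : x ∉ cube d ((1 + 1 / (m + 1 : ℝ)) * (n + 1))) : cutoff d m n x = 0 := by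
  rw [mem_cube_iff (by positivity), not_le] at hx
  refine (spaceBump d m).zero_of_le_dist ?_
  rw [dist_zero_right, norm_smul, norm_inv, Real.norm_of_nonneg (by positivity),
    le_inv_mul_iff₀ (by positivity)]
  simp only [spaceBump]
  linarith

theorem fderiv_comp_smul_apply {V : Type*} [NormedAddCommGroup V] [NormedSpace ℝ V] {χ : V → ℝ}
    (hχ : ContDiff ℝ ∞ χ) (c : ℝ) (x e : V) :
    fderiv ℝ (fun x => χ (c • x)) x e = c * fderiv ℝ χ (c • x) e := by
  have h := ((hχ.differentiable (by simp) (c • x)).hasFDerivAt).comp x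
    ((hasFDerivAt_id x).const_smul c)
  rw [show fderiv ℝ (fun x => χ (c • x)) x = _ from h.fderiv]
  simp

theorem integral_abs_comp_smul {ξ : (Fin d → ℝ) → ℝ} {N : ℝ} (hN : 0 < N) :
    ∫ x, |ξ (N⁻¹ • x)| = N ^ d * ∫ x, |ξ x| := by
  rw [Measure.integral_comp_inv_smul volume (fun x => |ξ x|) N]
  rw [Module.finrank_fintype_fun_eq_card, Fintype.card_fin, abs_of_pos (by positivity),
    smul_eq_mul]

/-- Rescaling gives N^d from the volume, N⁻¹ from each first derivative and N⁻² from each second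
derivative. As N ≥ 1, one factor N⁻¹ of the latter may be dropped. -/
theorem cutoffCost_comp_smul_le {K₁ : Fin d → ℝ} {K₂ : Fin d → Fin d → ℝ}
    (h₂ : ∀ i j, 0 ≤ K₂ i j) {χ : (Fin d → ℝ) → ℝ} (hχ : ContDiff ℝ ∞ χ) {N : ℝ} (hN : 1 ≤ N) :
    cutoffCost K₁ K₂ (fun x => χ (N⁻¹ • x)) ≤ N ^ d / N * cutoffCost K₁ K₂ χ := by
  have hN0 : 0 < N := by linarith
  have hχ1 := contDiff_fderiv_apply hχ
  have e1 : ∀ e x, fderiv ℝ (fun x => χ (N⁻¹ • x)) x e = N⁻¹ * fderiv ℝ χ (N⁻¹ • x) e :=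
    fun e x => fderiv_comp_smul_apply hχ _ x e
  have e2 : ∀ e e' x, fderiv ℝ (fun x => N⁻¹ * fderiv ℝ χ (N⁻¹ • x) e) x e' =
      N⁻¹ * (N⁻¹ * fderiv ℝ (fun x => fderiv ℝ χ x e) (N⁻¹ • x) e') := fun e e' x => by
    rw [← fderiv_comp_smul_apply (hχ1 e), fderiv_const_mul]
    · simp
    · have h1 := ((hχ1 e).comp (contDiff_const_smul N⁻¹)).differentiable (by simp) x
      exact h1
  have e3 : ∀ e, ∫ x, |fderiv ℝ χ (N⁻¹ • x) e| = N ^ d * ∫ x, |fderiv ℝ χ x e| :=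
    fun e => integral_abs_comp_smul (ξ := fun x => fderiv ℝ χ x e) hN0
  have e4 : ∀ e e', ∫ x, |fderiv ℝ (fun x => fderiv ℝ χ x e) (N⁻¹ • x) e'| =
      N ^ d * ∫ x, |fderiv ℝ (fun x => fderiv ℝ χ x e) x e'| := fun e e' =>
    integral_abs_comp_smul (ξ := fun x => fderiv ℝ (fun x => fderiv ℝ χ x e) x e') hN0
  unfold cutoffCost
  simp only [e1, e2, abs_mul, abs_of_pos (inv_pos.2 hN0), integral_const_mul, e3, e4]
  rw [mul_add, Finset.mul_sum, Finset.mul_sum]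
  refine add_le_add (le_of_eq (Finset.sum_congr rfl fun i _ => ?_))
    (Finset.sum_le_sum fun i _ => ?_)
  · field_simp
  · rw [Finset.mul_sum]
    refine Finset.sum_le_sum fun j _ => ?_
    set I := ∫ x, |fderiv ℝ (fun x => fderiv ℝ χ x (Pi.single j 1)) x (Pi.single i 1)|
    have hI : 0 ≤ I := integral_nonneg fun _ => abs_nonneg _
    have h3 : N⁻¹ * (K₂ i j * (N⁻¹ * (N ^ d * I))) ≤ K₂ i j * (N⁻¹ * (N ^ d * I)) :=
      mul_le_of_le_one_left (mul_nonneg (h₂ i j) (by positivity)) (inv_le_one_of_one_le₀ hN)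
    calc _ = N⁻¹ * (K₂ i j * (N⁻¹ * (N ^ d * I))) := by ring
      _ ≤ _ := h3
      _ = _ := by ring

theorem cutoffCost_cutoff_le {K₁ : Fin d → ℝ} {K₂ : Fin d → Fin d → ℝ}
    (h₂ : ∀ i j, 0 ≤ K₂ i j) (m n : ℕ) : cutoffCost K₁ K₂ (cutoff d m n) ≤
      (n + 1 : ℝ) ^ d / (n + 1) * cutoffCost K₁ K₂ (spaceBump d m) :=
  cutoffCost_comp_smul_le h₂ (spaceBump d m).contDiff (by
    have : (0 : ℝ) ≤ n := n.cast_nonneg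
    linarith)

theorem cutoffCost_nonneg {K₁ : Fin d → ℝ} {K₂ : Fin d → Fin d → ℝ}
    (h₁ : ∀ i, 0 ≤ K₁ i) (h₂ : ∀ i j, 0 ≤ K₂ i j) (χ : (Fin d → ℝ) → ℝ) :
    0 ≤ cutoffCost K₁ K₂ χ :=
  add_nonneg
    (Finset.sum_nonneg fun i _ => mul_nonneg (h₁ i) (integral_nonneg fun _ => abs_nonneg _))
    (Finset.sum_nonneg fun i _ => Finset.sum_nonneg fun j _ =>
      mul_nonneg (h₂ i j) (integral_nonneg fun _ => abs_nonneg _))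

/-! ### Comparison of Besicovitch seminorms -/

/-- The localized `L¹` norm of `g`, weighted with a cutoff. -/
noncomputable def cutoffNorm (m n : ℕ) (g : (Fin d → ℝ) → ℝ) : ℝ≥0∞ :=
  ∫⁻ x, ‖g x‖ₑ * ENNReal.ofReal (cutoff d m n x)

theorem lintegral_cube_le_cutoffNorm (m n : ℕ) (g : (Fin d → ℝ) → ℝ) :
    ∫⁻ x in cube d (n + 1), ‖g x‖ₑ ≤ cutoffNorm m n g := by
  rw [← lintegral_indicator (measurableSet_cube _)]
  refine lintegral_mono fun x => ?_
  by_cases hx : x ∈ cube d (n + 1)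
  · rw [indicator_of_mem hx, cutoff_eq_one hx]; simp
  · rw [indicator_of_notMem hx]; exact zero_le

theorem cutoffNorm_le_lintegral_cube (m n : ℕ) (g : (Fin d → ℝ) → ℝ) :
    cutoffNorm m n g ≤ ∫⁻ x in cube d ((1 + 1 / (m + 1 : ℝ)) * (n + 1)), ‖g x‖ₑ := by
  rw [← lintegral_indicator (measurableSet_cube _)]
  refine lintegral_mono fun x => ?_
  by_cases hx : x ∈ cube d ((1 + 1 / (m + 1 : ℝ)) * (n + 1))
  · rw [indicator_of_mem hx]
    refine mul_le_of_le_one_right' ?_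
    exact ENNReal.ofReal_le_one.2 (cutoff_le_one _ _ _)
  · rw [cutoff_eq_zero hx]; simp

/-- Passage from integer scales N = ⌊R⌋ + 1 to real R. As R ≤ N ≤ R + 1, the outer cube has side at
most (1 + 1/(m+1))(R + 1), and this is at most (1 + 2/(m+1))R exactly when R ≥ m + 2. -/
theorem lintegral_cube_le_of_cutoffNorm_le {g₀ g₁ : (Fin d → ℝ) → ℝ} {m : ℕ} {D : ℝ} (hD : 0 ≤ D)
    (h : ∀ n : ℕ, cutoffNorm m n g₁ ≤
      cutoffNorm m n g₀ + ENNReal.ofReal (D * ((n + 1 : ℝ) ^ d / (n + 1))))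
    {R : ℝ} (hR : (m + 2 : ℝ) ≤ R) :
    ∫⁻ x in cube d R, ‖g₁ x‖ₑ ≤ (∫⁻ x in cube d ((1 + 2 / (m + 1 : ℝ)) * R), ‖g₀ x‖ₑ)
      + ENNReal.ofReal (D * 2 ^ d / R) * ENNReal.ofReal R ^ d := by
  have hm : (0 : ℝ) ≤ m := m.cast_nonneg
  have hR0 : 0 < R := by linarith
  set n := ⌊R⌋₊
  have hn1 : R ≤ n + 1 := (Nat.lt_floor_add_one R).le
  have hn2 : (n + 1 : ℝ) ≤ R + 1 := by linarith [Nat.floor_le hR0.le]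
  have hn0 : (0 : ℝ) < n + 1 := by positivity
  calc ∫⁻ x in cube d R, ‖g₁ x‖ₑ ≤ ∫⁻ x in cube d (n + 1), ‖g₁ x‖ₑ :=
        lintegral_mono_set (cube_mono hn1)
    _ ≤ cutoffNorm m n g₁ := lintegral_cube_le_cutoffNorm _ _ _
    _ ≤ _ := h n
    _ ≤ _ := by
      refine add_le_add ((cutoffNorm_le_lintegral_cube _ _ _).trans
        (lintegral_mono_set (cube_mono ?_))) ?_
      · have h1 : (1 + 1 / (m + 1 : ℝ)) * (n + 1) ≤ (1 + 1 / (m + 1 : ℝ)) * (R + 1) :=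
          mul_le_mul_of_nonneg_left hn2 (by positivity)
        refine h1.trans ?_
        have h2 : (m + 1 : ℝ) ≠ 0 := by positivity
        rw [← sub_nonneg]
        have : (1 + 2 / (m + 1 : ℝ)) * R - (1 + 1 / (m + 1 : ℝ)) * (R + 1) =
            (R - (m + 2)) / (m + 1) := by field_simp; ring
        rw [this]
        exact div_nonneg (by linarith) (by positivity)
      · rw [← ENNReal.ofReal_pow hR0.le, ← ENNReal.ofReal_mul (by positivity)]
        refine ENNReal.ofReal_le_ofReal ?_
        -- Numerator and denominator use the two different bounds N ≤ 2R and N ≥ R, so the case d =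
        -- 0 needs no separate treatment.
        have h3 : (n + 1 : ℝ) ^ d / (n + 1) ≤ (2 * R) ^ d / R :=
          div_le_div₀ (by positivity) (pow_le_pow_left₀ hn0.le (by linarith) d) hR0 hn1
        calc D * ((n + 1 : ℝ) ^ d / (n + 1)) ≤ D * ((2 * R) ^ d / R) :=
              mul_le_mul_of_nonneg_left h3 hD
          _ = _ := by rw [mul_pow]; ring

/-- Enlarging the cube by λ = 1 + 2/(m+1) costs a factor λ^d after normalization, and the error is
O(1/R). Since R → ∞ is taken at fixed m, the constant D may depend on m; then m → ∞ sends λ^d to 1.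
-/
theorem besicovitchN1_le_of_cutoffNorm_le {g₀ g₁ : (Fin d → ℝ) → ℝ}
    (h : ∀ m : ℕ, ∃ D : ℝ, 0 ≤ D ∧ ∀ n : ℕ, cutoffNorm m n g₁ ≤
      cutoffNorm m n g₀ + ENNReal.ofReal (D * ((n + 1 : ℝ) ^ d / (n + 1)))) :
    besicovitchN1 g₁ ≤ besicovitchN1 g₀ := by
  refine le_of_forall_gt_imp_ge_of_dense fun b hb => ?_
  have hev : ∀ᶠ R : ℝ in atTop, (∫⁻ x in cube d R, ‖g₀ x‖ₑ) / ENNReal.ofReal R ^ d < b :=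
    eventually_lt_of_limsup_lt hb
  have hstep : ∀ m : ℕ, besicovitchN1 g₁ ≤ ENNReal.ofReal ((1 + 2 / (m + 1 : ℝ)) ^ d) * b := by
    intro m
    obtain ⟨D, hD, hmn⟩ := h m
    have hlam : 0 < 1 + 2 / (m + 1 : ℝ) := by positivity
    have hlim : Tendsto (fun R : ℝ => ENNReal.ofReal ((1 + 2 / (m + 1 : ℝ)) ^ d) * b +
        ENNReal.ofReal (D * 2 ^ d / R)) atTop
        (𝓝 (ENNReal.ofReal ((1 + 2 / (m + 1 : ℝ)) ^ d) * b + 0)) := by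
      refine tendsto_const_nhds.add ?_
      rw [← ENNReal.ofReal_zero]
      exact ENNReal.tendsto_ofReal (tendsto_const_nhds.div_atTop tendsto_id)
    rw [add_zero] at hlim
    rw [← hlim.limsup_eq]
    refine limsup_le_limsup ?_
    filter_upwards [(tendsto_id.const_mul_atTop hlam).eventually hev, eventually_gt_atTop 0,
      eventually_ge_atTop (m + 2 : ℝ)] with R h1 h2 h3
    have hR0 : ENNReal.ofReal R ^ d ≠ 0 := pow_ne_zero _ (ENNReal.ofReal_pos.2 h2).ne'
    have hRt : ENNReal.ofReal R ^ d ≠ ⊤ := ENNReal.pow_ne_top ENNReal.ofReal_ne_top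
    rw [ENNReal.div_le_iff hR0 hRt, add_mul]
    refine (lintegral_cube_le_of_cutoffNorm_le hD hmn h3).trans (add_le_add ?_ le_rfl)
    have h4 := h1.le
    simp only [id] at h4
    have hLR : 0 < (1 + 2 / (m + 1 : ℝ)) * R := mul_pos hlam h2
    rw [ENNReal.div_le_iff (pow_ne_zero _ (ENNReal.ofReal_pos.2 hLR).ne')
      (ENNReal.pow_ne_top ENNReal.ofReal_ne_top), ENNReal.ofReal_mul hlam.le, mul_pow] at h4
    refine h4.trans (le_of_eq ?_)
    rw [ENNReal.ofReal_pow hlam.le]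
    ring
  have hlim : Tendsto (fun m : ℕ => ENNReal.ofReal ((1 + 2 / (m + 1 : ℝ)) ^ d) * b) atTop
      (𝓝 (ENNReal.ofReal ((1 + 2 * 0) ^ d) * b)) := by
    refine ENNReal.Tendsto.mul_const ?_ (Or.inl (by simp))
    refine ENNReal.tendsto_ofReal (Tendsto.pow (tendsto_const_nhds.add ?_) d)
    have := (tendsto_one_div_add_atTop_nhds_zero_nat (𝕜 := ℝ)).const_mul 2
    refine this.congr fun m => ?_
    ring
  have := ge_of_tendsto' hlim hstep
  simpa using this

/-! ### Calculus of the weighted norms, the initial time, and conclusion -/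

theorem cutoffNorm_eq_ofReal {g : (Fin d → ℝ) → ℝ} {C : ℝ} (hg : Measurable g)
    (hC : ∀ x, |g x| ≤ C) (m n : ℕ) :
    cutoffNorm m n g = ENNReal.ofReal (∫ x, |g x| * cutoff d m n x) := by
  rw [ofReal_integral_eq_lintegral_ofReal]
  · refine lintegral_congr fun x => ?_
    rw [ENNReal.ofReal_mul (abs_nonneg _), ← Real.norm_eq_abs, ofReal_norm]
  · exact ((contDiff_cutoff m n).continuous.integrable_of_hasCompactSupport
      (hasCompactSupport_cutoff m n)).bdd_mul (c := C) hg.abs.aestronglyMeasurable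
      (Eventually.of_forall fun x => by rw [Real.norm_eq_abs, abs_abs]; exact hC x)
  · exact Eventually.of_forall fun x => mul_nonneg (abs_nonneg _) (cutoff_nonneg _ _ _)

theorem cutoffNorm_add_le {g₀ g₁ : (Fin d → ℝ) → ℝ} (h : AEStronglyMeasurable g₀) (m n : ℕ) :
    cutoffNorm m n (fun x => g₀ x + g₁ x) ≤ cutoffNorm m n g₀ + cutoffNorm m n g₁ := by
  unfold cutoffNorm
  rw [← lintegral_add_left']
  · refine lintegral_mono fun x => ?_
    rw [← add_mul]
    exact mul_le_mul_left (enorm_add_le _ _) _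
  · exact h.enorm.mul (contDiff_cutoff m n).continuous.measurable.ennreal_ofReal.aemeasurable

theorem cutoffNorm_neg (m n : ℕ) (g : (Fin d → ℝ) → ℝ) :
    cutoffNorm m n (fun x => -g x) = cutoffNorm m n g := by
  simp [cutoffNorm]

theorem cutoffNorm_congr_ae {g₀ g₁ : (Fin d → ℝ) → ℝ} (h : g₀ =ᵐ[volume] g₁) (m n : ℕ) :
    cutoffNorm m n g₀ = cutoffNorm m n g₁ := by
  refine lintegral_congr_ae ?_
  filter_upwards [h] with x hx
  rw [hx]

/-- Every interval (0, δ) has positive measure, so it meets every set of full measure. Without this,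
the essential limit at 0+ would carry no information. -/
theorem neBot_nhdsGT_inf_ae : (𝓝[>] (0 : ℝ) ⊓ ae volume).NeBot := by
  rw [inf_neBot_iff]
  intro s hs s' hs'
  obtain ⟨δ, hδ, hsub⟩ := mem_nhdsGT_iff_exists_Ioo_subset.1 hs
  by_contra hne
  rw [not_nonempty_iff_eq_empty] at hne
  have h1 : Ioo 0 δ ⊆ s'ᶜ := fun x hx hx' => (hne ▸ (⟨hsub hx, hx'⟩ : x ∈ s ∩ s') : x ∈ (∅ : Set ℝ))
  have h2 : volume (Ioo 0 δ) = 0 := measure_mono_null h1 hs'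
  rw [Real.volume_Ioo, sub_zero, ENNReal.ofReal_eq_zero] at h2
  exact absurd hδ (not_lt.2 h2)

/-- The localized `L¹` distance to the initial function vanishes as `t → 0+`. -/
theorem IsEntropySolution.tendsto_cutoffNorm {f : Fin d → ℝ → ℝ} {A σ : Fin d → Fin d → ℝ → ℝ}
    {u₀ : (Fin d → ℝ) → ℝ} {u : SpaceTime d → ℝ} (h : IsEntropySolution f A σ u₀ u) (m n : ℕ) :
    Tendsto (fun t => cutoffNorm m n fun x => u (t, x) - u₀ x) (𝓝[>] (0 : ℝ) ⊓ ae volume)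
      (𝓝 0) :=
  tendsto_of_tendsto_of_tendsto_of_le_of_le tendsto_const_nhds
    (h.initial ((1 + 1 / (m + 1 : ℝ)) * (n + 1)) (by positivity)) (fun _ => zero_le)
    fun _ => cutoffNorm_le_lintegral_cube m n _

theorem ae_ae_eq_of_ae_eq_halfVol {u U : SpaceTime d → ℝ} (h : u =ᵐ[halfVol d] U) :
    ∀ᵐ t : ℝ, 0 < t → (fun x => u (t, x)) =ᵐ[volume] fun x => U (t, x) := by
  rw [halfVol_eq_prod] at h
  exact (ae_restrict_iff' measurableSet_Ioi).1 (Measure.ae_ae_of_ae_prod h)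

/-- `L¹`-mean contraction for entropy solutions. -/
theorem IsEntropySolution.besicovitchN1_contraction {f : Fin d → ℝ → ℝ}
    {A σ : Fin d → Fin d → ℝ → ℝ} (hdata : IsData f A σ)
    {u₀ v₀ : (Fin d → ℝ) → ℝ} {u v : SpaceTime d → ℝ} (hu : IsEntropySolution f A σ u₀ u)
    (hv : IsEntropySolution f A σ v₀ v) :
    (∃ F : Set ℝ, F ⊆ Ioi 0 ∧ volume (Ioi 0 \ F) = 0 ∧
      ∀ t₀ ∈ F, ∀ t₁ ∈ F, t₀ < t₁ →
        besicovitchN1 (fun x => u (t₁, x) - v (t₁, x)) ≤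
          besicovitchN1 (fun x => u (t₀, x) - v (t₀, x))) ∧
    (∀ᵐ t ∂(volume.restrict (Ioi (0 : ℝ))),
      besicovitchN1 (fun x => u (t, x) - v (t, x)) ≤ besicovitchN1 (fun x => u₀ x - v₀ x)) := by
  obtain ⟨M₁, U, g, hU, huU⟩ := hu.exists_regular
  obtain ⟨M₂, V, h, hV, hvV⟩ := hv.exists_regular
  replace hU := hU.mono (le_max_left M₁ M₂)
  replace hV := hV.mono (le_max_right M₁ M₂)
  obtain ⟨K₁, K₂, hK₁, hK₂, growth⟩ := hU.exists_localized_growth hV hdata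
  choose S hSae hS using fun m n => growth (cutoff d m n) (contDiff_cutoff m n)
    (hasCompactSupport_cutoff m n) (cutoff_nonneg m n)
  -- Good times: the growth estimate holds for all the countably many cutoffs, and the time slices
  -- of u and v agree almost everywhere with those of the regular representatives.
  set F : Set ℝ := {t | 0 < t ∧ (∀ m n, t ∈ S m n) ∧
    ((fun x => u (t, x)) =ᵐ[volume] fun x => U (t, x)) ∧
    ((fun x => v (t, x)) =ᵐ[volume] fun x => V (t, x))} with hF
  have hFae : ∀ᵐ t : ℝ, 0 < t → t ∈ F := by
    filter_upwards [ae_all_iff.2 fun m => ae_all_iff.2 fun n => hSae m n,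
      ae_ae_eq_of_ae_eq_halfVol huU, ae_ae_eq_of_ae_eq_halfVol hvV] with t h1 h2 h3 ht
    exact ⟨ht, h1, h2 ht, h3 ht⟩
  have hmeas : ∀ t, Measurable fun x => U (t, x) - V (t, x) := fun t =>
    (hU.measurable.sub hV.measurable).comp measurable_prodMk_left
  have hbd : ∀ t x, |U (t, x) - V (t, x)| ≤ max M₁ M₂ + max M₁ M₂ := fun t x =>
    (abs_sub _ _).trans (add_le_add (hU.abs_le _) (hV.abs_le _))
  have hrep : ∀ t ∈ F, (fun x => u (t, x) - v (t, x)) =ᵐ[volume] fun x => U (t, x) - V (t, x) :=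
    fun t ht => ht.2.2.1.sub ht.2.2.2
  -- The error carries t₁ in place of t₁ - t₀. It is then independent of t₀ and survives the limit
  -- t₀ → 0+ unchanged.
  have hgrow : ∀ t₀ ∈ F, ∀ t₁ ∈ F, t₀ < t₁ → ∀ m n : ℕ,
      cutoffNorm m n (fun x => u (t₁, x) - v (t₁, x)) ≤
      cutoffNorm m n (fun x => u (t₀, x) - v (t₀, x)) +
        ENNReal.ofReal (cutoffCost K₁ K₂ (spaceBump d m) * t₁ * ((n + 1 : ℝ) ^ d / (n + 1))) := by
    intro t₀ h₀ t₁ h₁ hlt m n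
    rw [cutoffNorm_congr_ae (hrep t₁ h₁), cutoffNorm_congr_ae (hrep t₀ h₀),
      cutoffNorm_eq_ofReal (hmeas t₁) (hbd t₁), cutoffNorm_eq_ofReal (hmeas t₀) (hbd t₀)]
    have hcost := cutoffCost_nonneg hK₁ hK₂ (spaceBump d m)
    have ht₀ := h₀.1
    have ht₁ := h₁.1
    rw [← ENNReal.ofReal_add
      (integral_nonneg fun x => mul_nonneg (abs_nonneg _) (cutoff_nonneg _ _ _)) (by positivity)]
    refine ENNReal.ofReal_le_ofReal
      ((hS m n t₀ (h₀.2.1 m n) t₁ (h₁.2.1 m n) ht₀ hlt).trans (add_le_add le_rfl ?_))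
    calc cutoffCost K₁ K₂ (cutoff d m n) * (t₁ - t₀)
        ≤ (n + 1 : ℝ) ^ d / (n + 1) * cutoffCost K₁ K₂ (spaceBump d m) * t₁ :=
          mul_le_mul (cutoffCost_cutoff_le hK₂ m n) (by linarith) (by linarith) (by positivity)
      _ = _ := by ring
  refine ⟨⟨F, fun t ht => ht.1, ?_, fun t₀ h₀ t₁ h₁ hlt => ?_⟩, ?_⟩
  · have : volume {t : ℝ | ¬(0 < t → t ∈ F)} = 0 := hFae
    refine measure_mono_null (fun t ht => ?_) this
    exact fun h => ht.2 (h ht.1)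
  · exact besicovitchN1_le_of_cutoffNorm_le fun m => ⟨_,
      mul_nonneg (cutoffCost_nonneg hK₁ hK₂ _) h₁.1.le, hgrow t₀ h₀ t₁ h₁ hlt m⟩
  · rw [ae_restrict_iff' measurableSet_Ioi]
    filter_upwards [hFae] with t₁ ht₁ hpos
    have h₁ := ht₁ hpos
    -- The initial data are attained only locally in L¹, so the seminorms at times t₀ need not
    -- converge as t₀ → 0+. The limit is therefore taken in the growth estimate at fixed m and n,
    -- and the large-scale limit comes last.
    refine besicovitchN1_le_of_cutoffNorm_le fun m => ⟨_,
      mul_nonneg (cutoffCost_nonneg hK₁ hK₂ (spaceBump d m)) h₁.1.le, fun n => ?_⟩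
    have hlim := ((hu.tendsto_cutoffNorm m n).add (hv.tendsto_cutoffNorm m n)).const_add
      (cutoffNorm m n (fun x => u₀ x - v₀ x))
    have hlim' := hlim.add_const (ENNReal.ofReal
      (cutoffCost K₁ K₂ (spaceBump d m) * t₁ * ((n + 1 : ℝ) ^ d / (n + 1))))
    rw [add_zero, add_zero] at hlim'
    have := neBot_nhdsGT_inf_ae
    refine ge_of_tendsto hlim' ?_
    have hpos' : ∀ᶠ t in 𝓝[>] (0 : ℝ) ⊓ ae volume, t ∈ Ioo 0 t₁ :=
      mem_inf_of_left (Ioo_mem_nhdsGT hpos)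
    have hFae' : ∀ᶠ t in 𝓝[>] (0 : ℝ) ⊓ ae volume, 0 < t → t ∈ F := mem_inf_of_right hFae
    filter_upwards [hpos', hFae'] with t₀ ht₀ hF₀
    have h₀ := hF₀ ht₀.1
    refine (hgrow t₀ h₀ t₁ h₁ ht₀.2 m n).trans (add_le_add ?_ le_rfl)
    -- Measurability of u on space-time gives none on an individual slice; at a good time it is
    -- inherited from the Borel representative.
    have hum : AEStronglyMeasurable fun x => u (t₀, x) :=
      ((hU.measurable.comp measurable_prodMk_left).aestronglyMeasurable).congr h₀.2.2.1.symm
    have hu₀ := hu.memLp_init.aestronglyMeasurable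
    have hv₀ := hv.memLp_init.aestronglyMeasurable
    calc cutoffNorm m n (fun x => u (t₀, x) - v (t₀, x))
        = cutoffNorm m n (fun x => (u₀ x - v₀ x) +
            ((u (t₀, x) - u₀ x) + -(v (t₀, x) - v₀ x))) := by
          congr 1; funext x; ring
      _ ≤ _ := cutoffNorm_add_le (hu₀.sub hv₀) m n
      _ ≤ _ := by
          refine add_le_add le_rfl ?_
          rw [← cutoffNorm_neg m n fun x => v (t₀, x) - v₀ x]
          exact cutoffNorm_add_le (hum.sub hu₀) m n

end DegenerateParabolic

theorem proposition2p1 {d : ℕ} (f : Fin d → ℝ → ℝ) (A σ : Fin d → Fin d → ℝ → ℝ)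
    (hdata : DegenerateParabolic.IsData f A σ)
    (u₀ v₀ : (Fin d → ℝ) → ℝ) (u v : ℝ × (Fin d → ℝ) → ℝ)
    (hu : DegenerateParabolic.IsEntropySolution f A σ u₀ u)
    (hv : DegenerateParabolic.IsEntropySolution f A σ v₀ v) :
    (∃ F : Set ℝ, F ⊆ Ioi 0 ∧ volume (Ioi 0 \ F) = 0 ∧
      ∀ t₀ ∈ F, ∀ t₁ ∈ F, t₀ < t₁ →
        DegenerateParabolic.besicovitchN1 (fun x => u (t₁, x) - v (t₁, x)) ≤
          DegenerateParabolic.besicovitchN1 (fun x => u (t₀, x) - v (t₀, x))) ∧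
    (∀ᵐ t ∂(volume.restrict (Ioi (0 : ℝ))),
      DegenerateParabolic.besicovitchN1 (fun x => u (t, x) - v (t, x)) ≤
        DegenerateParabolic.besicovitchN1 (fun x => u₀ x - v₀ x)) :=
  hu.besicovitchN1_contraction hdata hv
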